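/- Conventions. For a set $X$, let $\mathcal{IS}(X)$ be the semigroup of all partial bijections of $X$, acting on the right (in $ab$ first $a$ is applied, then $b$), and $\mathcal{IS}_n=\mathcal{IS}(\{1,\dots,n\})$. For a semigroup $S$ and a semigroup $P$ of partial bijections of $X$, the partial wreath product $S\wr_p P$ is the set of pairs $(f,a)$ with $a\in P$ and $f:\operatorname{dom}(a)\to S$, with product $(f,a)(g,b)=(f g^{a},ab)$, where $(f g^a)(x)=f(x)\,g(xa)$ for $x\in\operatorname{dom}(ab)$. In a semigroup $H$ write $a\mathrel{\mathcal R}b$ if $aH^1=bH^1$, and $a\mathrel{\mathcal L}b$ if $H^1a=H^1b$. An $\mathcal R$-cross-section (respectively $\mathcal L$-cross-section) of $H$ is a subsemigroup that contains exactly one element of every $\mathcal R$-class (respectively $\mathcal L$-class) of $H$. For a finite linearly ordered set $\overrightarrow{M}=\{m_1<\dots<m_r\}$ and $1\le j\le r$, let $a_j\in\mathcal{IS}(M)$ be the partial bijection with $m_i\mapsto m_{i+1}$ for $i<j$, undefined at $m_j$, and $m_i\mapsto m_i$ for $i>j$. Let $R(\overrightarrow{M})=\langle a_1,\dots,a_r\rangle\cup\{\mathrm{id}_M\}$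 and $L(\overrightarrow{M})=\{a^{-1}: a\in R(\overrightarrow{M})\}$. Let $\{1,\dots,n\}=M_1\sqcup\dots\sqcup M_k$ be a decomposition into non-empty blocks with a linear order on each block. A direct product $P_1\times\dots\times P_k$ of subsemigroups $P_i\subseteq S\wr_p\mathcal{IS}(M_i)$ is regarded as a subsemigroup of $S\wr_p\mathcal{IS}_n$ by sending $((f_i,a_i))_{i}$ to the element $(f,a)$ that restricts to $(f_i,a_i)$ on $M_i$ for every $i$. Theorem. Let $S$ be a finite inverse semigroup with zero and identity, and let $n\ge 0$. (1) For every decomposition $\{1,\dots,n\}=M_1\sqcup\dots\sqcup M_k$ into non-empty linearly ordered blocks and all $\mathcal R$-cross-sections $R_1,\dots,R_k$ of $S$, the product $$(R_1\wr_p R(\overrightarrow{M_1}))\times\dots\times(R_k\wr_p R(\overrightarrow{M_k}))$$ is an $\mathcal R$-cross-section of $S\wr_p\mathcal{IS}_n$. Conversely, every $\mathcal R$-cross-section of $S\wr_p\mathcal{IS}_n$ is isomorphic, as a semigroup, to such a product for some decomposition of $\{1,\dots,n\}$ into non-empty linearly ordered blocks and some $\mathcal R$-cross-sections $R_1,\dots,R_k$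 of $S$. (2) Dually, for every such decomposition and all $\mathcal L$-cross-sections $L_1,\dots,L_k$ of $S$, the product $$(L_1\wr_p L(\overrightarrow{M_1}))\times\dots\times(L_k\wr_p L(\overrightarrow{M_k}))$$ is an $\mathcal L$-cross-section of $S\wr_p\mathcal{IS}_n$, and every $\mathcal L$-cross-section of $S\wr_p\mathcal{IS}_n$ is isomorphic, as a semigroup, to such a product for some decomposition of $\{1,\dots,n\}$ into non-empty linearly ordered blocks and some $\mathcal L$-cross-sections $L_1,\dots,L_k$ of $S$. -/

import Mathlib

universe u v

/-! ### Semigroups, Green's relations, cross-sections -/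

/-- A semigroup is inverse if each `a` has exactly one `b` with `aba = a` and `bab = b`. -/
def IsInverseSemigroup (H : Type u) [Semigroup H] : Prop :=
  ∀ a : H, ∃! b : H, a * b * a = a ∧ b * a * b = b

/-- Green's relation R: `a H¹ = b H¹`. -/
def GreenR {H : Type u} [Semigroup H] (a b : H) : Prop :=
  insert a (Set.range fun h : H => a * h) = insert b (Set.range fun h : H => b * h)

/-- Green's relation L: `H¹ a = H¹ b`. -/
def GreenL {H : Type u} [Semigroup H] (a b : H) : Prop :=
  insert a (Set.range fun h : H => h * a) = insert b (Set.range fun h : H => h * b)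

/-- A subsemigroup `T` is a cross-section with respect to `ρ` if it contains exactly one element
of every class of `ρ`. -/
def IsCrossSection {H : Type u} [Semigroup H] (ρ : H → H → Prop) (T : Subsemigroup H) : Prop :=
  ∀ a : H, ∃! t : H, t ∈ T ∧ ρ a t

/-- R-cross-sections. -/
def IsRCrossSection {H : Type u} [Semigroup H] (T : Subsemigroup H) : Prop :=
  IsCrossSection GreenR T

/-- L-cross-sections. -/
def IsLCrossSection {H : Type u} [Semigroup H] (T : Subsemigroup H) : Prop :=
  IsCrossSection GreenL T

/-! ### The symmetric inverse semigroup -/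

/-- The semigroup of all partial bijections of `X`. Maps act on the right: in the product `a * b`
first `a` is applied, then `b`. -/
def ISym (X : Type u) : Type u := X ≃. X

namespace ISym

variable {X : Type u}

/-- The value of `a` at `x`, which is `none` if `x` is outside the domain of `a`. -/
def app (a : ISym X) (x : X) : Option X := (show X ≃. X from a) x

/-- The inverse partial bijection. -/
def inv (a : ISym X) : ISym X := PEquiv.symm a

theorem ext {a b : ISym X} (h : ∀ x, a.app x = b.app x) : a = b := PEquiv.ext h

instance : Monoid (ISym X) where
  mul a b := PEquiv.trans a b
  one := PEquiv.refl X
  mul_assoc a b c := PEquiv.trans_assoc a b c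
  one_mul a := PEquiv.refl_trans a
  mul_one a := PEquiv.trans_refl a

theorem mul_app (a b : ISym X) (x : X) : (a * b).app x = (a.app x).bind b.app := rfl

theorem inv_mul (a b : ISym X) : (a * b).inv = b.inv * a.inv := PEquiv.symm_trans_rev a b

/-- The partial bijection with graph `r`, for a functional and injective relation `r`. -/
noncomputable def ofRel (r : X → X → Prop) (hf : ∀ x y z, r x y → r x z → y = z)
    (hi : ∀ x y z, r x z → r y z → x = y) : ISym X := by
  classical
  exact
    { toFun := fun x => if h : ∃ y, r x y then some h.choose else none
      invFun := fun y => if h : ∃ x, r x y then some h.choose else none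
      inv := by
        have h1 : ∀ x y : X, y ∈ (if h : ∃ y, r x y then some h.choose else none : Option X) ↔
            r x y := by
          intro x y
          split_ifs with h
          · constructor
            · intro e
              rw [Option.mem_some_iff] at e
              exact e ▸ h.choose_spec
            · intro e
              rw [Option.mem_some_iff]
              exact hf _ _ _ h.choose_spec e
          · simp only [Option.not_mem_none, false_iff]
            exact fun e => h ⟨y, e⟩
        have h2 : ∀ x y : X, x ∈ (if h : ∃ x, r x y then some h.choose else none : Option X) ↔
            r x y := by
          intro x y
          split_ifs with h
          · constructor
            · intro e
              rw [Option.mem_some_iff] at e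
              exact e ▸ h.choose_spec
            · intro e
              rw [Option.mem_some_iff]
              exact hi _ _ _ h.choose_spec e
          · simp only [Option.not_mem_none, false_iff]
            exact fun e => h ⟨x, e⟩
        intro x y
        exact (h2 x y).trans (h1 x y).symm }

theorem ofRel_app (r : X → X → Prop) (hf : ∀ x y z, r x y → r x z → y = z)
    (hi : ∀ x y z, r x z → r y z → x = y) (x y : X) :
    (ofRel r hf hi).app x = some y ↔ r x y := by
  classical
  change (if h : ∃ y, r x y then some h.choose else none : Option X) = some y ↔ _
  split_ifs with h
  · constructor
    · intro e
      exact Option.some.inj e ▸ h.choose_spec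
    · intro e
      exact congrArg some (hf _ _ _ h.choose_spec e)
  · simp only [false_iff]
    exact fun e => h ⟨y, e⟩

/-- For a (finite) linearly ordered set `m₁ < m₂ < ⋯` and `j = m_l`, the element with chain
`[m₁, m₂, …, m_l]`: it maps `m_i` to `m_{i+1}` for `i < l`, is undefined at `m_l`, and fixes every
`m_i` with `i > l`. -/
noncomputable def chain [LinearOrder X] (j : X) : ISym X :=
  ofRel (fun x y => (x < j ∧ x ⋖ y) ∨ (j < x ∧ y = x))
    (by
      rintro x y z (⟨h1, h2⟩ | ⟨h1, rfl⟩) (⟨h3, h4⟩ | ⟨h3, rfl⟩)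
      · exact h2.unique_right h4
      · exact absurd h1 h3.not_gt
      · exact absurd h1 h3.not_gt
      · rfl)
    (by
      rintro x y z (⟨h1, h2⟩ | ⟨h1, rfl⟩) (⟨h3, h4⟩ | ⟨h3, h4⟩)
      · exact h2.unique_left h4
      · subst h4
        exact absurd h3 (h2.ge_of_gt h1).not_gt
      · exact absurd h1 (h4.ge_of_gt h3).not_gt
      · exact h4)

end ISym

/-- The semigroup `R(M⃗)` of a linearly ordered block `M`: the elements `chain j`, `j ∈ M`, generate
it together with the identity. -/
noncomputable def chainR (M : Type u) (o : LinearOrder M) : Subsemigroup (ISym M) :=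
  (Submonoid.closure (Set.range fun j : M => @ISym.chain M o j)).toSubsemigroup

/-- The semigroup `L(M⃗)` of the inverses of the elements of `R(M⃗)`. -/
noncomputable def chainL (M : Type u) (o : LinearOrder M) : Subsemigroup (ISym M) where
  carrier := {a | a.inv ∈ chainR M o}
  mul_mem' := by
    intro a b ha hb
    change (a * b).inv ∈ chainR M o
    rw [ISym.inv_mul]
    exact mul_mem hb ha

/-! ### The partial wreath product -/

/-- Pointwise product of partial functions from `X` to `S`, defined on the intersection of the
domains. -/
def pmul {X : Type u} {S : Type v} [Mul S] (f g : X → Option S) : X → Option S :=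
  fun x => Option.map₂ (· * ·) (f x) (g x)

/-- The partial function `f^a : x ↦ f (x a)`. -/
def twist {X : Type u} {S : Type v} (f : X → Option S) (a : ISym X) : X → Option S :=
  fun x => (a.app x).bind f

/-- The partial wreath product of `S` with the semigroup of all partial bijections of `X`: pairs
`(f, a)` where `f` is a partial function from `X` to `S` with the same domain as `a`. -/
structure PWreath (S : Type v) (X : Type u) where
  fn : X → Option S
  act : ISym X
  dom_eq : ∀ x, (fn x).isSome = (act.app x).isSome

namespace PWreath

variable {S : Type v} {X : Type u}

@[ext] theorem ext {w z : PWreath S X} (h1 : w.fn = z.fn) (h2 : w.act = z.act) : w = z := by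
  cases w; cases z; cases h1; cases h2; rfl

/-- `(f, a) (g, b) = (f g^a, a b)`. -/
instance [Mul S] : Mul (PWreath S X) where
  mul w z :=
    { fn := pmul w.fn (twist z.fn w.act)
      act := w.act * z.act
      dom_eq := by
        intro x
        have h1 := w.dom_eq x
        rw [ISym.mul_app]
        unfold pmul twist
        cases ha : w.act.app x with
        | none => simp
        | some y =>
          rw [ha] at h1
          obtain ⟨s, hs⟩ := Option.isSome_iff_exists.mp h1
          have h2 := z.dom_eq y
          rw [hs]
          cases hg : z.fn y <;> simp_all }

theorem mul_fn [Mul S] (w z : PWreath S X) : (w * z).fn = pmul w.fn (twist z.fn w.act) := rfl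

theorem mul_act [Mul S] (w z : PWreath S X) : (w * z).act = w.act * z.act := rfl

instance [Semigroup S] : Semigroup (PWreath S X) where
  mul_assoc w z t := by
    ext1
    · funext x
      simp only [mul_fn, mul_act, pmul, twist, ISym.mul_app]
      cases ha : w.act.app x with
      | none => simp
      | some y =>
        have h : pmul z.fn (twist t.fn z.act) y =
            Option.map₂ (· * ·) (z.fn y) ((z.act.app y).bind t.fn) := rfl
        simp only [Option.bind_some, h]
        cases w.fn x <;> cases z.fn y <;> cases z.act.app y <;> simp [mul_assoc]
    · exact mul_assoc _ _ _

/-- The partial wreath product of a subsemigroup `T` of `S` with a semigroup `Q` of partial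
bijections of `X`, as a subsemigroup of the full partial wreath product. -/
def sub [Semigroup S] (T : Subsemigroup S) (Q : Subsemigroup (ISym X)) :
    Subsemigroup (PWreath S X) where
  carrier := {w | w.act ∈ Q ∧ ∀ x s, w.fn x = some s → s ∈ T}
  mul_mem' := by
    rintro w z ⟨hw, hw'⟩ ⟨hz, hz'⟩
    refine ⟨mul_mem hw hz, fun x s h => ?_⟩
    obtain ⟨p, q, hp, hq, rfl⟩ := Option.map₂_eq_some_iff.mp h
    obtain ⟨y, -, hy⟩ := Option.bind_eq_some_iff.mp hq
    exact mul_mem (hw' x p hp) (hz' y q hy)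

end PWreath

/-! ### Decompositions into linearly ordered blocks -/

/-- A decomposition of `N` into a disjoint union of non-empty blocks `M₁, …, M_k`, with a linear
order on each block. The linear orders are arbitrary. -/
structure OrderedDecomposition (N : Type u) where
  k : ℕ
  block : Fin k → Set N
  nonempty : ∀ i, (block i).Nonempty
  disjoint : ∀ i j, i ≠ j → Disjoint (block i) (block j)
  cover : ∀ x, ∃ i, x ∈ block i
  order : ∀ i, LinearOrder (block i)

namespace OrderedDecomposition

variable {N : Type u} (D : OrderedDecomposition N)

/-- The index of the block that contains `x`. -/
noncomputable def idx (x : N) : Fin D.k := (D.cover x).choose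

theorem mem_idx (x : N) : x ∈ D.block (D.idx x) := (D.cover x).choose_spec

theorem idx_eq {x : N} {i : Fin D.k} (h : x ∈ D.block i) : D.idx x = i := by
  by_contra hne
  exact Set.disjoint_left.mp (D.disjoint _ _ hne) (D.mem_idx x) h

/-- The partial bijection of `N` that acts on each block `M_i` as `a i`. -/
noncomputable def glueAct (a : ∀ i, ISym (D.block i)) : ISym N :=
  ISym.ofRel (fun x y => ∃ (i : Fin D.k) (hx : x ∈ D.block i) (hy : y ∈ D.block i),
      (a i).app ⟨x, hx⟩ = some ⟨y, hy⟩)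
    (by
      rintro x y z ⟨i, hx, hy, h⟩ ⟨j, hx', hz, h'⟩
      obtain rfl : i = j := (D.idx_eq hx).symm.trans (D.idx_eq hx')
      rw [h] at h'
      exact congrArg Subtype.val (Option.some.inj h'))
    (by
      rintro x y z ⟨i, hx, hz, h⟩ ⟨j, hy, hz', h'⟩
      obtain rfl : i = j := (D.idx_eq hz).symm.trans (D.idx_eq hz')
      exact congrArg Subtype.val (PEquiv.inj (a i) h h'))

theorem glueAct_app (a : ∀ i, ISym (D.block i)) (i : Fin D.k) (x : D.block i) :
    (D.glueAct a).app x = ((a i).app x).map Subtype.val := by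
  ext y
  rw [glueAct, ISym.ofRel_app, Option.map_eq_some_iff]
  constructor
  · rintro ⟨j, hx, hy, h⟩
    obtain rfl : i = j := (D.idx_eq x.2).symm.trans (D.idx_eq hx)
    exact ⟨_, h, rfl⟩
  · rintro ⟨z, h, rfl⟩
    exact ⟨i, x.2, z.2, h⟩

/-- The partial function on `N` that is `f i` on each block `M_i`. -/
noncomputable def glueFn {S : Type v} (f : ∀ i, D.block i → Option S) : N → Option S :=
  fun x => f (D.idx x) ⟨x, D.mem_idx x⟩

theorem glueFn_apply {S : Type v} (f : ∀ i, D.block i → Option S) (i : Fin D.k)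
    (x : D.block i) : D.glueFn f x = f i x := by
  obtain ⟨x, hx⟩ := x
  obtain rfl := D.idx_eq hx
  rfl

/-- The canonical embedding of the direct product of the partial wreath products over the blocks
into the partial wreath product over `N`: it sends a family `(f_i, a_i)` to the element `(f, a)`
where `f`, `a` restrict to `f_i`, `a_i` on `M_i` for all `i`. -/
noncomputable def glue {S : Type v} [Semigroup S] :
    (∀ i, PWreath S (D.block i)) →ₙ* PWreath S N where
  toFun w :=
    { fn := D.glueFn fun i => (w i).fn
      act := D.glueAct fun i => (w i).act
      dom_eq := by
        intro x
        have h := D.glueAct_app (fun i => (w i).act) (D.idx x) ⟨x, D.mem_idx x⟩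
        have h' := D.glueFn_apply (fun i => (w i).fn) (D.idx x) ⟨x, D.mem_idx x⟩
        simp only at h h'
        rw [h, h', Option.isSome_map]
        exact (w _).dom_eq _ }
  map_mul' := by
    intro w z
    have key : ∀ x : N, ∃ (i : Fin D.k) (y : D.block i), (y : N) = x :=
      fun x => ⟨D.idx x, ⟨x, D.mem_idx x⟩, rfl⟩
    apply PWreath.ext
    · funext x
      obtain ⟨i, y, rfl⟩ := key x
      simp only [PWreath.mul_fn, pmul, twist, glueFn_apply, glueAct_app, Pi.mul_apply]
      cases (w i).act.app y with
      | none => simp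
      | some q => simp [glueFn_apply]
    · apply ISym.ext
      intro x
      obtain ⟨i, y, rfl⟩ := key x
      simp only [PWreath.mul_act, ISym.mul_app, glueAct_app, Pi.mul_apply]
      cases (w i).act.app y with
      | none => simp
      | some q => simp [glueAct_app]

theorem glue_injective {S : Type v} [Semigroup S] :
    Function.Injective (D.glue (S := S)) := by
  intro w z h
  funext i
  apply PWreath.ext
  · funext x
    have := congrArg (fun t : PWreath S N => t.fn x) h
    simpa [glue, glueFn_apply] using this
  · apply ISym.ext
    intro x
    have := congrArg (fun t : PWreath S N => t.act.app x) h
    simp only [glue, MulHom.coe_mk, glueAct_app] at this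
    exact Option.map_injective Subtype.val_injective this

/-- For subsemigroups `P_i` of the partial wreath products over the blocks, the direct product
`P₁ × ⋯ × P_k` viewed inside the partial wreath product over `N`. -/
noncomputable def prodIn {S : Type v} [Semigroup S]
    (P : ∀ i, Subsemigroup (PWreath S (D.block i))) : Subsemigroup (PWreath S N) where
  carrier := {w | ∃ p : ∀ i, PWreath S (D.block i), (∀ i, p i ∈ P i) ∧ D.glue p = w}
  mul_mem' := by
    rintro _ _ ⟨p, hp, rfl⟩ ⟨q, hq, rfl⟩
    exact ⟨p * q, fun i => mul_mem (hp i) (hq i), map_mul _ _ _⟩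

/-- The factor `R_i ≀ₚ R(M⃗_i)`. -/
noncomputable def factorR {S : Type v} [Semigroup S] (R : Fin D.k → Subsemigroup S)
    (i : Fin D.k) : Subsemigroup (PWreath S (D.block i)) :=
  PWreath.sub (R i) (chainR (D.block i) (D.order i))

/-- The factor `L_i ≀ₚ L(M⃗_i)`. -/
noncomputable def factorL {S : Type v} [Semigroup S] (L : Fin D.k → Subsemigroup S)
    (i : Fin D.k) : Subsemigroup (PWreath S (D.block i)) :=
  PWreath.sub (L i) (chainL (D.block i) (D.order i))

end OrderedDecomposition

/-! ### Green's relations in monoids and cross-sections -/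

/-! In the partial wreath product, R-equivalence means equal domains together with pointwise
R-equivalence of the values (`greenR_tot`). A cross-section therefore combines two independent
choices: one partial bijection for each domain, and one representative for each R-class of S.
Submonoids of the first kind are captured by `IsDomTransversal`. The chain semigroups have this
property because an order-preserving partial bijection whose image is an upper set is determined by
its domain (`eq_of_mem_shiftUp`). Gluing blocks preserves the property, which gives the direct half.

For the converse, let T be an R-cross-section. The R-class of 0 in S is {0}, so the a with (0, a) ∈
T form a domain-transversal submonoid Q, and every element of T acts by an element of Q. Such a Q is
always a product of chain semigroups (`eq_prodAct`): its reachability relation is a partial order,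
each orbit has one final point, the points sharing a final point form a block, and the elements
undefined at a single point are exactly the chains of the blocks.

It remains to untwist the values. The elements (f, 1) of T are those with f x in a cross-section R_x
of S (`valuesAt`), and over each a ∈ Q lies an element of T with unit values c. These units form a
coboundary: c x = d x (d y)⁻¹ whenever a sends x to y (`units_mul_transition`), with d x read off
over the domain {x}. Conjugation by the diagonal element (d, 1) carries the standard product, with
R_i taken at the top of block i, onto T.

The L-statement follows by transport along the antiautomorphism (f, a) ↦ (f, a)⁻¹ induced by
inversion in S. -/

theorem greenR_iff {H : Type u} [Monoid H] {a b : H} :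
    GreenR a b ↔ (∃ h, a * h = b) ∧ ∃ h, b * h = a := by
  have key : ∀ c : H, insert c (Set.range fun h : H => c * h) = Set.range fun h : H => c * h :=
    fun c => Set.insert_eq_of_mem ⟨1, mul_one c⟩
  unfold GreenR
  rw [key, key]
  constructor
  · intro h
    have hb : b ∈ Set.range fun h : H => a * h := h ▸ ⟨1, mul_one b⟩
    have ha : a ∈ Set.range fun h : H => b * h := h ▸ ⟨1, mul_one a⟩
    exact ⟨hb, ha⟩
  · rintro ⟨⟨p, rfl⟩, q, hq⟩
    ext c
    constructor
    · rintro ⟨r, rfl⟩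
      exact ⟨q * r, by simp only [← mul_assoc, hq]⟩
    · rintro ⟨r, rfl⟩
      exact ⟨p * r, by simp only [mul_assoc]⟩

namespace GreenR

theorem refl {H : Type u} [Semigroup H] (a : H) : GreenR a a := Eq.refl _

theorem symm {H : Type u} [Semigroup H] {a b : H} (h : GreenR a b) : GreenR b a := Eq.symm h

theorem trans {H : Type u} [Semigroup H] {a b c : H} (h : GreenR a b) (h' : GreenR b c) :
    GreenR a c := Eq.trans h h'

theorem mul_left {H : Type u} [Monoid H] {a b : H} (c : H) (h : GreenR a b) :
    GreenR (c * a) (c * b) := by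
  obtain ⟨⟨p, hp⟩, q, hq⟩ := greenR_iff.mp h
  exact greenR_iff.mpr ⟨⟨p, by rw [mul_assoc, hp]⟩, q, by rw [mul_assoc, hq]⟩

theorem mul_unit {H : Type u} [Monoid H] (a : H) {c c' : H} (hc : c * c' = 1) :
    GreenR (a * c) a :=
  greenR_iff.mpr ⟨⟨c', by rw [mul_assoc, hc, mul_one]⟩, c, rfl⟩

theorem one_iff {H : Type u} [Monoid H] [Finite H] {a : H} : GreenR 1 a ↔ IsUnit a := by
  rw [greenR_iff]
  constructor
  · rintro ⟨-, h, hh⟩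
    exact IsUnit.of_mul_eq_one h hh
  · rintro ⟨a, rfl⟩
    exact ⟨⟨a, one_mul _⟩, ↑a⁻¹, a.mul_inv⟩

theorem eq_zero {H : Type u} [MonoidWithZero H] {a : H} (h : GreenR 0 a) : a = 0 := by
  obtain ⟨⟨p, hp⟩, -⟩ := greenR_iff.mp h
  rw [← hp, zero_mul]

end GreenR

theorem IsRCrossSection.eq_of_greenR {H : Type u} [Semigroup H] {T : Subsemigroup H}
    (hT : IsRCrossSection T) {a b : H} (ha : a ∈ T) (hb : b ∈ T) (h : GreenR a b) : a = b :=
  (hT a).unique ⟨ha, GreenR.refl a⟩ ⟨hb, h⟩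

theorem IsRCrossSection.exists_mem {H : Type u} [Semigroup H] {T : Subsemigroup H}
    (hT : IsRCrossSection T) (a : H) : ∃ t ∈ T, GreenR a t :=
  let ⟨t, ht, _⟩ := hT a
  ⟨t, ht.1, ht.2⟩

theorem isRCrossSection_of {H : Type u} [Semigroup H] {T : Subsemigroup H}
    (h : ∀ a, ∃ t ∈ T, GreenR a t) (h' : ∀ a ∈ T, ∀ b ∈ T, GreenR a b → a = b) :
    IsRCrossSection T := by
  intro a
  obtain ⟨t, ht, hat⟩ := h a
  exact ⟨t, ⟨ht, hat⟩, fun s hs => h' s hs.1 t ht (hs.2.symm.trans hat)⟩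

/-! ### Domains of partial bijections -/

namespace ISym

variable {X : Type u}

theorem one_app (x : X) : (1 : ISym X).app x = some x := rfl

theorem app_inj {a : ISym X} {x y z : X} (hx : a.app x = some z) (hy : a.app y = some z) : x = y :=
  PEquiv.inj a hx hy

theorem inv_app {a : ISym X} {x y : X} : a.inv.app y = some x ↔ a.app x = some y :=
  PEquiv.mem_iff_mem a

theorem inv_inv (a : ISym X) : a.inv.inv = a := PEquiv.symm_symm a

theorem mul_app_some {a b : ISym X} {x z : X} :
    (a * b).app x = some z ↔ ∃ y, a.app x = some y ∧ b.app y = some z := by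
  rw [mul_app, Option.bind_eq_some_iff]

theorem mul_app_of {a : ISym X} (b : ISym X) {x y : X} (h : a.app x = some y) :
    (a * b).app x = b.app y := by
  rw [mul_app, h, Option.bind_some]

theorem ext_some {a b : ISym X} (h : ∀ x y, a.app x = some y ↔ b.app x = some y) : a = b :=
  ext fun x => Option.ext (h x)

instance [Finite X] : Finite (ISym X) :=
  Finite.of_injective (fun a : ISym X => a.app) fun _ _ h => ext fun x => congrFun h x

/-- The domain of a partial bijection. -/
def dom (a : ISym X) : Set X := {x | ∃ y, a.app x = some y}

theorem mem_dom {a : ISym X} {x : X} : x ∈ a.dom ↔ ∃ y, a.app x = some y := Iff.rfl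

theorem mem_dom_isSome {a : ISym X} {x : X} : x ∈ a.dom ↔ (a.app x).isSome = true :=
  Option.isSome_iff_exists.symm

theorem mem_dom_mul {a b : ISym X} {x : X} :
    x ∈ (a * b).dom ↔ ∃ y, a.app x = some y ∧ y ∈ b.dom := by
  simp only [mem_dom, mul_app_some]
  exact exists_comm.trans (by simp only [exists_and_left])

theorem dom_mul_subset (a b : ISym X) : (a * b).dom ⊆ a.dom := fun _ hx =>
  let ⟨y, hy, _⟩ := mem_dom_mul.mp hx
  ⟨y, hy⟩

theorem app_eq_none {a : ISym X} {x : X} (h : x ∉ a.dom) : a.app x = none := by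
  by_contra h'
  exact h (Option.ne_none_iff_exists'.mp h')

theorem eq_one_of_mul_self {a : ISym X} (ha : a.dom = Set.univ) (h : a * a = a) : a = 1 := by
  apply ext
  intro x
  obtain ⟨y, hy⟩ : x ∈ a.dom := ha ▸ Set.mem_univ x
  have h1 := mul_app_of a hy
  rw [h] at h1
  rw [one_app, hy, app_inj hy (h1 ▸ hy)]

/-- A submonoid of the symmetric inverse semigroup has transversal domains if it contains exactly
one element with any given domain. -/
def IsDomTransversal (Q : Submonoid (ISym X)) : Prop := ∀ A : Set X, ∃! a, a ∈ Q ∧ a.dom = A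

/-- Points are deleted one at a time: if a has domain sᶜ and sends i to j, then following a by an
element undefined only at j removes exactly i from the domain. -/
theorem exists_mem_dom_eq [Finite X] {K : Submonoid (ISym X)}
    (hK : ∀ i, ∃ a ∈ K, a.dom = {i}ᶜ) (A : Set X) : ∃ a ∈ K, a.dom = A := by
  suffices h : ∀ s : Set X, ∃ a ∈ K, a.dom = sᶜ by simpa using h Aᶜ
  intro s
  induction s, s.toFinite using Set.Finite.induction_on with
  | empty => exact ⟨1, one_mem K, by ext x; simp [mem_dom, one_app]⟩
  | @insert i s hi _ ih =>
    obtain ⟨a, ha, has⟩ := ih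
    obtain ⟨j, hj⟩ : i ∈ a.dom := has ▸ hi
    obtain ⟨e, he, hej⟩ := hK j
    refine ⟨a * e, mul_mem ha he, ?_⟩
    ext x
    rw [mem_dom_mul, hej]
    constructor
    · rintro ⟨y, hy, hyj⟩ (rfl | hx)
      · exact hyj (Option.some.inj (hy.symm.trans hj))
      · have : x ∈ a.dom := ⟨y, hy⟩
        rw [has] at this
        exact this hx
    · intro hx
      obtain ⟨y, hy⟩ : x ∈ a.dom := has ▸ fun h => hx (Or.inr h)
      refine ⟨y, hy, ?_⟩
      rintro rfl
      exact hx (Or.inl (app_inj hy hj))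

namespace IsDomTransversal

variable {Q : Submonoid (ISym X)}

theorem eq_of_dom (hQ : IsDomTransversal Q) {a b : ISym X} (ha : a ∈ Q) (hb : b ∈ Q)
    (h : a.dom = b.dom) : a = b :=
  (hQ b.dom).unique ⟨ha, h⟩ ⟨hb, rfl⟩

theorem exists_dom (hQ : IsDomTransversal Q) (A : Set X) : ∃ a ∈ Q, a.dom = A :=
  let ⟨a, ha, _⟩ := hQ A
  ⟨a, ha.1, ha.2⟩

end IsDomTransversal

theorem isDomTransversal_of [Finite X] {K : Submonoid (ISym X)}
    (hK : ∀ i, ∃ a ∈ K, a.dom = {i}ᶜ)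
    (h : ∀ a ∈ K, ∀ b ∈ K, a.dom = b.dom → a = b) : IsDomTransversal K := by
  intro A
  obtain ⟨a, ha, haA⟩ := exists_mem_dom_eq hK A
  exact ⟨a, ⟨ha, haA⟩, fun b hb => h b hb.1 a ha (hb.2.trans haA.symm)⟩

/-! ### The semigroup of a linearly ordered block -/

section Chain

variable [LinearOrder X]

theorem chain_app {j x y : X} :
    (chain j).app x = some y ↔ (x < j ∧ x ⋖ y) ∨ (j < x ∧ y = x) := ofRel_app _ _ _ x y

theorem chain_app_self (j : X) : (chain j).app j = none := by
  rw [Option.eq_none_iff_forall_not_mem]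
  intro y hy
  rcases chain_app.mp hy with h | h <;> exact lt_irrefl _ h.1

theorem dom_chain [Finite X] (j : X) : (chain j).dom = {j}ᶜ := by
  ext x
  rw [Set.mem_compl_singleton_iff]
  constructor
  · rintro ⟨y, hy⟩ rfl
    rw [chain_app_self] at hy
    cases hy
  · intro h
    rcases lt_or_gt_of_ne h with h | h
    · obtain ⟨y, hy, -⟩ := exists_covBy_le_of_lt h
      exact ⟨y, chain_app.mpr (Or.inl ⟨h, hy⟩)⟩
    · exact ⟨x, chain_app.mpr (Or.inr ⟨h, rfl⟩)⟩

/-- The partial bijections that preserve the order and have an upper set as image. -/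
def shiftUp (X : Type u) [LinearOrder X] : Submonoid (ISym X) where
  carrier := {a | ∀ x u, a.app x = some u → ∀ z, u < z ↔ ∃ y, x < y ∧ a.app y = some z}
  one_mem' := by
    intro x u h z
    obtain rfl := Option.some.inj h
    constructor
    · exact fun hz => ⟨z, hz, rfl⟩
    · rintro ⟨y, hy, h⟩
      exact (Option.some.inj h) ▸ hy
  mul_mem' := by
    intro a b ha hb x v h z
    obtain ⟨u, hu, hv⟩ := mul_app_some.mp h
    rw [hb u v hv z]
    constructor
    · rintro ⟨w, hw, hz⟩
      obtain ⟨y, hy, hyw⟩ := (ha x u hu w).mp hw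
      exact ⟨y, hy, mul_app_some.mpr ⟨w, hyw, hz⟩⟩
    · rintro ⟨y, hy, hz⟩
      obtain ⟨w, hw, hz⟩ := mul_app_some.mp hz
      exact ⟨w, (ha x u hu w).mpr ⟨y, hy, hw⟩, hz⟩

theorem chain_mem_shiftUp [Finite X] (j : X) : chain j ∈ shiftUp X := by
  intro x u hu z
  rw [chain_app] at hu
  simp only [chain_app]
  rcases hu with ⟨hx, hxu⟩ | ⟨hx, rfl⟩
  · constructor
    · intro huz
      rcases le_or_gt z j with hz | hz
      · obtain ⟨y, hyz⟩ := exists_le_covBy_of_lt huz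
        exact ⟨y, hxu.lt.trans_le hyz.1, Or.inl ⟨hyz.2.lt.trans_le hz, hyz.2⟩⟩
      · exact ⟨z, hxu.lt.trans huz, Or.inr ⟨hz, rfl⟩⟩
    · rintro ⟨y, hxy, ⟨hy, hyz⟩ | ⟨hy, rfl⟩⟩
      · exact (hxu.ge_of_gt hxy).trans_lt hyz.lt
      · exact (hxu.ge_of_gt hx).trans_lt hy
  · constructor
    · exact fun hz => ⟨z, hz, Or.inr ⟨hx.trans hz, rfl⟩⟩
    · rintro ⟨y, hxy, ⟨hy, hyz⟩ | ⟨hy, rfl⟩⟩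
      · exact hxy.trans hyz.lt
      · exact hxy

/-- Values are forced from the largest point downwards: the points above the image of x are
precisely the images of the domain points above x, and this set determines the image of x. -/
theorem eq_of_mem_shiftUp [Finite X] {a b : ISym X} (ha : a ∈ shiftUp X) (hb : b ∈ shiftUp X)
    (h : a.dom = b.dom) : a = b := by
  apply ext
  intro x
  induction x using WellFoundedGT.induction with
  | ind x ih =>
    by_cases hx : x ∈ a.dom
    · obtain ⟨u, hu⟩ := hx
      obtain ⟨v, hv⟩ : x ∈ b.dom := h ▸ ⟨u, hu⟩
      have huv : ∀ z, u < z ↔ v < z := by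
        intro z
        rw [ha x u hu z, hb x v hv z]
        exact exists_congr fun y => and_congr_right fun hy => by rw [ih y hy]
      rw [hu, hv, le_antisymm (not_lt.mp fun hvu => lt_irrefl _ ((huv u).mpr hvu))
        (not_lt.mp fun huv' => lt_irrefl _ ((huv v).mp huv'))]
    · rw [app_eq_none hx, app_eq_none (h ▸ hx)]

theorem isDomTransversal_closure_chain [Finite X] :
    IsDomTransversal (Submonoid.closure (Set.range fun j : X => chain j)) := by
  have hle : Submonoid.closure (Set.range fun j : X => chain j) ≤ shiftUp X := by
    rw [Submonoid.closure_le]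
    rintro _ ⟨j, rfl⟩
    exact chain_mem_shiftUp j
  exact isDomTransversal_of
    (fun j => ⟨chain j, Submonoid.subset_closure ⟨j, rfl⟩, dom_chain j⟩)
    fun a ha b hb h => eq_of_mem_shiftUp (hle ha) (hle hb) h

end Chain

end ISym

/-! ### Gluing the blocks of a decomposition -/

namespace OrderedDecomposition

variable {X : Type u} (D : OrderedDecomposition X)

theorem exists_block (x : X) : ∃ (i : Fin D.k) (y : D.block i), (y : X) = x :=
  ⟨D.idx x, ⟨x, D.mem_idx x⟩, rfl⟩

theorem glueAct_mul (a b : ∀ i, ISym (D.block i)) :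
    D.glueAct (fun i => a i * b i) = D.glueAct a * D.glueAct b := by
  apply ISym.ext
  intro x
  obtain ⟨i, y, rfl⟩ := D.exists_block x
  simp only [ISym.mul_app, glueAct_app]
  cases (a i).app y with
  | none => simp
  | some q => simp [glueAct_app]

theorem glueAct_one : D.glueAct (fun _ => 1) = 1 := by
  apply ISym.ext
  intro x
  obtain ⟨i, y, rfl⟩ := D.exists_block x
  simp [glueAct_app, ISym.one_app]

theorem mem_dom_glueAct (a : ∀ i, ISym (D.block i)) {i : Fin D.k} (x : D.block i) :
    (x : X) ∈ (D.glueAct a).dom ↔ x ∈ (a i).dom := by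
  simp only [ISym.mem_dom_isSome, glueAct_app, Option.isSome_map]

/-- The direct product of the semigroups `R(M⃗_i)`. -/
noncomputable def prodAct : Submonoid (ISym X) where
  carrier := {a | ∃ p : ∀ i, ISym (D.block i),
    (∀ i, p i ∈ chainR (D.block i) (D.order i)) ∧ D.glueAct p = a}
  one_mem' := ⟨fun _ => 1, fun i => Submonoid.one_mem (Submonoid.closure _), D.glueAct_one⟩
  mul_mem' := by
    rintro _ _ ⟨p, hp, rfl⟩ ⟨q, hq, rfl⟩
    exact ⟨fun i => p i * q i, fun i => mul_mem (hp i) (hq i), D.glueAct_mul p q⟩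

theorem chainR_unique {M : Type u} [Finite M] (o : LinearOrder M) (A : Set M) :
    ∃! a, a ∈ chainR M o ∧ a.dom = A :=
  @ISym.isDomTransversal_closure_chain M o _ A

theorem isDomTransversal_prodAct [Finite X] : ISym.IsDomTransversal D.prodAct := by
  intro A
  choose p hp using fun i => (chainR_unique (D.order i) (Subtype.val ⁻¹' A)).exists
  refine ⟨D.glueAct p, ⟨⟨p, fun i => (hp i).1, rfl⟩, ?_⟩, ?_⟩
  · ext x
    obtain ⟨i, y, rfl⟩ := D.exists_block x
    rw [mem_dom_glueAct, (hp i).2, Set.mem_preimage]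
  · rintro _ ⟨⟨q, hq, rfl⟩, rfl⟩
    congr 1
    funext i
    refine (chainR_unique (D.order i) _).unique ⟨hq i, ?_⟩ (hp i)
    ext x
    rw [Set.mem_preimage, mem_dom_glueAct]

end OrderedDecomposition

/-! ### Submonoids with transversal domains are products over blocks -/

namespace ISym

variable {X : Type u} {Q : Submonoid (ISym X)}

/-- `y` lies in the orbit of `x`. -/
def Reach (Q : Submonoid (ISym X)) (x y : X) : Prop := ∃ a ∈ Q, a.app x = some y

theorem Reach.refl (x : X) : Reach Q x x := ⟨1, one_mem Q, rfl⟩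

theorem Reach.trans {x y z : X} : Reach Q x y → Reach Q y z → Reach Q x z := by
  rintro ⟨a, ha, hx⟩ ⟨b, hb, hy⟩
  exact ⟨a * b, mul_mem ha hb, mul_app_some.mpr ⟨y, hx, hy⟩⟩

namespace IsDomTransversal

/-- If a leads from x to y and b back, then g = ab fixes x. By finiteness the powers of g repeat, so
a high power absorbs a on the right, and evaluation at x gives y = x. -/
theorem reach_antisymm [Finite X] (hQ : IsDomTransversal Q) {x y : X} (h : Reach Q x y)
    (h' : Reach Q y x) : x = y := by
  obtain ⟨a, ha, hx⟩ := h
  obtain ⟨b, hb, hy⟩ := h'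
  have hg : (a * b).app x = some x := mul_app_some.mpr ⟨y, hx, hy⟩
  have hpow : ∀ k : ℕ, ((a * b) ^ k).app x = some x := by
    intro k
    induction k with
    | zero => rw [pow_zero, one_app]
    | succ k ih => rw [pow_succ, mul_app_of _ ih, hg]
  obtain ⟨i, j, hij, hp⟩ : ∃ i j : ℕ, i < j ∧ (a * b) ^ i = (a * b) ^ j := by
    obtain ⟨i, j, hne, hp⟩ := Finite.exists_ne_map_eq_of_infinite fun k : ℕ => (a * b) ^ k
    rcases lt_or_gt_of_ne hne with h | h
    · exact ⟨i, j, h, hp⟩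
    · exact ⟨j, i, h, hp.symm⟩
  obtain ⟨d, rfl⟩ := Nat.exists_eq_add_of_lt hij
  have hmem : (a * b) ^ i ∈ Q := pow_mem (mul_mem ha hb) i
  have hfix : (a * b) ^ i * a = (a * b) ^ i := by
    apply hQ.eq_of_dom (mul_mem hmem ha) hmem
    apply (dom_mul_subset _ _).antisymm
    -- The repetition g^i = g^(i+d+1) factors through g^i a, so multiplying g^i by a loses no part
    -- of the domain; transversality then gives g^i a = g^i.
    have e : (a * b) ^ i = (a * b) ^ i * a * (b * (a * b) ^ d) := by
      conv_lhs => rw [hp]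
      rw [add_assoc, pow_add, pow_succ']
      simp only [mul_assoc]
    intro z hz
    rw [e] at hz
    exact dom_mul_subset _ _ hz
  have h1 := mul_app_of a (hpow i)
  rw [hfix, hpow i, hx] at h1
  exact Option.some.inj h1

/-- Permits induction from the final points backwards: the hypothesis is available at every other
point that x reaches. -/
theorem wellFounded_reach [Finite X] (hQ : IsDomTransversal Q) :
    WellFounded fun y x => Reach Q x y ∧ x ≠ y := by
  have : IsTrans X fun y x => Reach Q x y ∧ x ≠ y := ⟨by
    rintro z y x ⟨h1, n1⟩ ⟨h2, n2⟩
    refine ⟨h2.trans h1, ?_⟩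
    rintro rfl
    exact n1 (hQ.reach_antisymm h1 h2)⟩
  have : Std.Irrefl fun y x => Reach Q x y ∧ x ≠ y := ⟨fun _ h => h.2 rfl⟩
  exact Finite.wellFounded_of_trans_of_irrefl _

/-- The element with a given domain. -/
noncomputable def elt (hQ : IsDomTransversal Q) (A : Set X) : ISym X := (hQ.exists_dom A).choose

theorem elt_mem (hQ : IsDomTransversal Q) (A : Set X) : hQ.elt A ∈ Q :=
  (hQ.exists_dom A).choose_spec.1

theorem dom_elt (hQ : IsDomTransversal Q) (A : Set X) : (hQ.elt A).dom = A :=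
  (hQ.exists_dom A).choose_spec.2

/-- The largest point of the orbit of `x`. -/
noncomputable def top (hQ : IsDomTransversal Q) (x : X) : X :=
  Exists.choose (show x ∈ (hQ.elt {x}).dom from (hQ.dom_elt {x}).symm ▸ Set.mem_singleton x)

theorem elt_singleton (hQ : IsDomTransversal Q) (x : X) :
    (hQ.elt {x}).app x = some (hQ.top x) :=
  Exists.choose_spec (show x ∈ (hQ.elt {x}).dom from
    (hQ.dom_elt {x}).symm ▸ Set.mem_singleton x)

theorem reach_top (hQ : IsDomTransversal Q) (x : X) : Reach Q x (hQ.top x) :=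
  ⟨_, hQ.elt_mem {x}, hQ.elt_singleton x⟩

/-- Both sides have domain {x}. Hence `top` is constant along orbits, and units over {x} and {y} can
be compared. -/
theorem mul_elt_singleton (hQ : IsDomTransversal Q) {a : ISym X} (ha : a ∈ Q) {x y : X}
    (h : a.app x = some y) : a * hQ.elt {y} = hQ.elt {x} := by
  apply hQ.eq_of_dom (mul_mem ha (hQ.elt_mem _)) (hQ.elt_mem _)
  ext z
  rw [mem_dom_mul, dom_elt, dom_elt, Set.mem_singleton_iff]
  constructor
  · rintro ⟨w, hw, rfl⟩
    exact app_inj hw h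
  · rintro rfl
    exact ⟨y, h, rfl⟩

theorem top_eq_of_reach (hQ : IsDomTransversal Q) {x y : X} (h : Reach Q x y) :
    hQ.top x = hQ.top y := by
  obtain ⟨a, ha, hx⟩ := h
  have h1 := mul_app_of (hQ.elt {y}) hx
  rw [hQ.mul_elt_singleton ha hx, elt_singleton, elt_singleton] at h1
  exact Option.some.inj h1

theorem top_top (hQ : IsDomTransversal Q) (x : X) : hQ.top (hQ.top x) = hQ.top x :=
  (hQ.top_eq_of_reach (hQ.reach_top x)).symm

theorem eq_of_reach_of_top_eq [Finite X] (hQ : IsDomTransversal Q) {x y : X} (hx : hQ.top x = x)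
    (h : Reach Q x y) : y = x := by
  refine hQ.reach_antisymm ?_ h
  have := hQ.reach_top y
  rwa [← hQ.top_eq_of_reach h, hx] at this

/-- The element that is undefined only at `i`. -/
noncomputable def del (hQ : IsDomTransversal Q) (i : X) : ISym X := hQ.elt {i}ᶜ

theorem del_mem (hQ : IsDomTransversal Q) (i : X) : hQ.del i ∈ Q := hQ.elt_mem _

theorem mem_dom_del (hQ : IsDomTransversal Q) {i x : X} : x ∈ (hQ.del i).dom ↔ x ≠ i := by
  rw [del, dom_elt, Set.mem_compl_singleton_iff]

theorem reach_del (hQ : IsDomTransversal Q) {i x y : X} (h : (hQ.del i).app x = some y) :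
    Reach Q x y := ⟨_, hQ.del_mem i, h⟩

theorem ne_of_del (hQ : IsDomTransversal Q) {i x y : X} (h : (hQ.del i).app x = some y) : x ≠ i :=
  hQ.mem_dom_del.mp ⟨y, h⟩

theorem del_self (hQ : IsDomTransversal Q) (i : X) : (hQ.del i).app i = none :=
  app_eq_none fun h => hQ.mem_dom_del.mp h rfl

/-- Iterate `del i`. By injectivity a point entered from elsewhere is not fixed, so the trajectory
keeps moving up the reachability order and can only stop at i. -/
theorem reach_of_moved [Finite X] (hQ : IsDomTransversal Q) {i x y : X}
    (h : (hQ.del i).app x = some y) (hne : y ≠ x) : Reach Q y i := by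
  induction y using hQ.wellFounded_reach.induction generalizing x with
  | _ y ih =>
    by_cases hy : y = i
    · exact hy ▸ Reach.refl y
    · obtain ⟨z, hz⟩ := hQ.mem_dom_del.mpr hy
      have hzy : z ≠ y := by
        rintro rfl
        exact hne (app_inj hz h)
      exact (hQ.reach_del hz).trans (ih z ⟨hQ.reach_del hz, hzy.symm⟩ hz hzy)

/-- Both products delete exactly i and j. -/
theorem del_mul_del (hQ : IsDomTransversal Q) {i j k : X} (hi : (hQ.del j).app i = some k)
    (hj : (hQ.del i).app j = some j) : hQ.del i * hQ.del j = hQ.del j * hQ.del k := by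
  apply hQ.eq_of_dom (mul_mem (hQ.del_mem _) (hQ.del_mem _))
    (mul_mem (hQ.del_mem _) (hQ.del_mem _))
  ext x
  simp only [mem_dom_mul, mem_dom_del]
  constructor
  · rintro ⟨y, hy, hyj⟩
    have hxj : x ≠ j := by
      rintro rfl
      exact hyj (Option.some.inj (hy.symm.trans hj))
    obtain ⟨z, hz⟩ := hQ.mem_dom_del.mpr hxj
    refine ⟨z, hz, ?_⟩
    rintro rfl
    exact hQ.ne_of_del hy (app_inj hz hi)
  · rintro ⟨y, hy, hyk⟩
    have hxi : x ≠ i := by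
      rintro rfl
      exact hyk (Option.some.inj (hy.symm.trans hi))
    obtain ⟨z, hz⟩ := hQ.mem_dom_del.mpr hxi
    refine ⟨z, hz, ?_⟩
    rintro rfl
    exact hQ.ne_of_del hy (app_inj hz hj)

/-- `x` is moved by the element that is undefined only at `i`. -/
def Prec (hQ : IsDomTransversal Q) (x i : X) : Prop := ∃ y, (hQ.del i).app x = some y ∧ y ≠ x

theorem Prec.reach [Finite X] {hQ : IsDomTransversal Q} {x i : X} :
    hQ.Prec x i → Reach Q x i ∧ x ≠ i := by
  rintro ⟨y, hy, hne⟩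
  exact ⟨(hQ.reach_del hy).trans (hQ.reach_of_moved hy hne), hQ.ne_of_del hy⟩

theorem del_app_of_not_prec (hQ : IsDomTransversal Q) {x i : X} (hx : x ≠ i)
    (h : ¬ hQ.Prec x i) : (hQ.del i).app x = some x := by
  obtain ⟨y, hy⟩ := hQ.mem_dom_del.mpr hx
  by_cases hne : y = x
  · rw [hy, hne]
  · exact absurd ⟨y, hy, hne⟩ h

/-- Let `del j` send i to k. If it fixed x, then `del_mul_del` would force `del k` to move x. Since
k lies strictly beyond i, the induction hypothesis at k, or k = j itself, yields a contradiction. -/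
theorem Prec.trans [Finite X] {hQ : IsDomTransversal Q} {x i j : X} (h : hQ.Prec x i)
    (h' : hQ.Prec i j) : hQ.Prec x j := by
  induction i using hQ.wellFounded_reach.induction with
  | _ i ih =>
    obtain ⟨hij, hne⟩ := h'.reach
    have hj : (hQ.del i).app j = some j := hQ.del_app_of_not_prec hne.symm fun hji =>
      hne (hQ.reach_antisymm hij hji.reach.1)
    obtain ⟨k, hk, hki⟩ := h'
    have hcomm := hQ.del_mul_del hk hj
    obtain ⟨y, hy, hyx⟩ := h
    have hyj : y ≠ j := by
      rintro rfl
      exact hne (hQ.reach_antisymm hij (hQ.reach_of_moved hy hyx))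
    obtain ⟨z, hz⟩ := hQ.mem_dom_del.mpr hyj
    have hxz : (hQ.del j * hQ.del k).app x = some z := by
      rw [← hcomm, mul_app_of _ hy, hz]
    by_contra hnp
    have hxj : x ≠ j := by
      rintro rfl
      exact hne (hQ.reach_antisymm hij ((hQ.reach_del hy).trans (hQ.reach_of_moved hy hyx)))
    rw [mul_app_of _ (hQ.del_app_of_not_prec hxj hnp)] at hxz
    have hxk : hQ.Prec x k := by
      refine ⟨z, hxz, ?_⟩
      rintro rfl
      exact hyx (hQ.reach_antisymm (hQ.reach_del hz) (hQ.reach_del hy))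
    by_cases hkj : k = j
    · exact hnp (hkj ▸ hxk)
    · obtain ⟨w, hw⟩ := hQ.mem_dom_del.mpr hkj
      refine hnp (ih k ⟨hQ.reach_del hk, hki.symm⟩ hxk ⟨w, hw, ?_⟩)
      rintro rfl
      exact hki (app_inj hw hk)

theorem exists_prec [Finite X] (hQ : IsDomTransversal Q) {x : X} (h : hQ.top x ≠ x) :
    ∃ i, hQ.Prec x i := by
  by_contra! hx
  -- If no `del i` moves x, this submonoid contains every `del i` and so realizes every domain. It
  -- then contains the element with domain {x}, which must fix x.
  let K : Submonoid (ISym X) :=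
    { carrier := {a | a ∈ Q ∧ ∀ y, a.app x = some y → y = x}
      one_mem' := ⟨one_mem Q, fun y hy => (Option.some.inj hy).symm⟩
      mul_mem' := by
        rintro a b ⟨ha, ha'⟩ ⟨hb, hb'⟩
        refine ⟨mul_mem ha hb, fun z hz => ?_⟩
        obtain ⟨y, hy, hyz⟩ := mul_app_some.mp hz
        obtain rfl := ha' y hy
        exact hb' z hyz }
  obtain ⟨a, ha, had⟩ := exists_mem_dom_eq (K := K) (fun i => ⟨hQ.del i, ⟨hQ.del_mem i, by
    intro y hy
    by_contra hne
    exact hx i ⟨y, hy, hne⟩⟩, hQ.dom_elt _⟩) {x}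
  obtain rfl := hQ.eq_of_dom ha.1 (hQ.elt_mem {x}) (had.trans (hQ.dom_elt _).symm)
  exact h (ha.2 _ (hQ.elt_singleton x))

/-- Transitivity pushes a deletion that moves x along its orbit up to the top. Thus deleting the top
moves every other point of the block, and this defines the successor. -/
theorem prec_top [Finite X] (hQ : IsDomTransversal Q) {x : X} (h : hQ.top x ≠ x) :
    hQ.Prec x (hQ.top x) := by
  obtain ⟨i, hi⟩ := hQ.exists_prec h
  induction i using hQ.wellFounded_reach.induction with
  | _ i ih =>
    by_cases hit : hQ.top i = i
    · rwa [hQ.top_eq_of_reach hi.reach.1, hit]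
    · obtain ⟨j, hj⟩ := hQ.exists_prec hit
      exact ih j hj.reach (hi.trans hj)

/-- The successor of `x` in its block. -/
theorem exists_succ [Finite X] (hQ : IsDomTransversal Q) {x : X} (h : hQ.top x ≠ x) :
    ∃ y, (hQ.del (hQ.top x)).app x = some y ∧ y ≠ x ∧ hQ.top y = hQ.top x := by
  obtain ⟨y, hy, hne⟩ := hQ.prec_top h
  exact ⟨y, hy, hne, (hQ.top_eq_of_reach (hQ.reach_del hy)).symm⟩

theorem exists_rank [Finite X] (hQ : IsDomTransversal Q) (x : X) :
    ∃ k : ℕ, (hQ.del (hQ.top x) ^ k).app x = some (hQ.top x) := by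
  induction x using hQ.wellFounded_reach.induction with
  | _ x ih =>
    by_cases h : hQ.top x = x
    · exact ⟨0, by rw [pow_zero, one_app, h]⟩
    · obtain ⟨y, hy, hne, hty⟩ := hQ.exists_succ h
      obtain ⟨k, hk⟩ := ih y ⟨hQ.reach_del hy, hne.symm⟩
      exact ⟨k + 1, by rw [pow_succ', mul_app_of _ hy, ← hty, hk]⟩

/-- The number of steps from `x` to the top of its block. -/
noncomputable def rank [Finite X] (hQ : IsDomTransversal Q) (x : X) : ℕ :=
  (hQ.exists_rank x).choose

theorem rank_spec [Finite X] (hQ : IsDomTransversal Q) (x : X) :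
    (hQ.del (hQ.top x) ^ hQ.rank x).app x = some (hQ.top x) := (hQ.exists_rank x).choose_spec

theorem rank_unique [Finite X] (hQ : IsDomTransversal Q) {x : X} {k : ℕ}
    (h : (hQ.del (hQ.top x) ^ k).app x = some (hQ.top x)) : k = hQ.rank x := by
  have key : ∀ p q : ℕ, (hQ.del (hQ.top x) ^ p).app x = some (hQ.top x) →
      (hQ.del (hQ.top x) ^ q).app x = some (hQ.top x) → ¬ p < q := by
    intro p q hp hq hpq
    obtain ⟨d, rfl⟩ := Nat.exists_eq_add_of_lt hpq
    rw [add_assoc, pow_add, mul_app_of _ hp, pow_succ', mul_app, del_self] at hq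
    cases hq
  rcases lt_trichotomy k (hQ.rank x) with h' | h' | h'
  · exact absurd h' (key _ _ h (hQ.rank_spec x))
  · exact h'
  · exact absurd h' (key _ _ (hQ.rank_spec x) h)

theorem rank_succ [Finite X] (hQ : IsDomTransversal Q) {x y : X}
    (h : (hQ.del (hQ.top x)).app x = some y) : hQ.rank x = hQ.rank y + 1 := by
  refine (hQ.rank_unique ?_).symm
  have := hQ.rank_spec y
  rw [← hQ.top_eq_of_reach (hQ.reach_del h)] at this
  rw [pow_succ', mul_app_of _ h, this]

theorem rank_top [Finite X] (hQ : IsDomTransversal Q) {x : X} (h : hQ.top x = x) :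
    hQ.rank x = 0 :=
  (hQ.rank_unique (by rw [pow_zero, one_app, h])).symm

theorem top_ne_of_rank_pos [Finite X] (hQ : IsDomTransversal Q) {x : X} (h : 0 < hQ.rank x) :
    hQ.top x ≠ x := fun h' => h.ne' (hQ.rank_top h')

theorem rank_inj [Finite X] (hQ : IsDomTransversal Q) {x y : X} (h : hQ.top x = hQ.top y)
    (h' : hQ.rank x = hQ.rank y) : x = y := by
  have hx := hQ.rank_spec x
  rw [h, h'] at hx
  exact app_inj hx (hQ.rank_spec y)

theorem del_app_of_top_ne [Finite X] (hQ : IsDomTransversal Q) {i x : X}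
    (h : hQ.top x ≠ hQ.top i) : (hQ.del i).app x = some x :=
  hQ.del_app_of_not_prec (fun e => h (e ▸ rfl)) fun hp => h (hQ.top_eq_of_reach hp.reach.1)

theorem app_of_top_eq [Finite X] (hQ : IsDomTransversal Q) {a : ISym X} (ha : a ∈ Q) {x : X}
    (hx : hQ.top x = x) (h : x ∈ a.dom) : a.app x = some x := by
  obtain ⟨y, hy⟩ := h
  rw [hy, hQ.eq_of_reach_of_top_eq hx ⟨a, ha, hy⟩]

/-- Rank decreases towards the top: points below i move to their successor and points above i stay
fixed. The induction compares deletion of i with deletion of its successor k. -/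
theorem del_app [Finite X] (hQ : IsDomTransversal Q) {i x : X} (hx : hQ.top x = hQ.top i) :
    (hQ.rank i < hQ.rank x → (hQ.del i).app x = (hQ.del (hQ.top i)).app x) ∧
      (hQ.rank x < hQ.rank i → (hQ.del i).app x = some x) := by
  generalize hr : hQ.rank i = r
  induction r generalizing i x with
  | zero =>
    have hi : hQ.top i = i :=
      hQ.rank_inj (hQ.top_top i) (by rw [hr, hQ.rank_top (hQ.top_top i)])
    exact ⟨fun _ => by rw [hi], fun h => absurd h (Nat.not_lt_zero _)⟩
  | succ r ih =>
    have hi : hQ.top i ≠ i := hQ.top_ne_of_rank_pos (hr ▸ Nat.succ_pos r)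
    obtain ⟨k, hk, -, hkt⟩ := hQ.exists_succ hi
    have hrk : hQ.rank k = r := by
      have := hQ.rank_succ hk
      omega
    have hcomm := hQ.del_mul_del hk
      (hQ.app_of_top_eq (hQ.del_mem i) (hQ.top_top i) (hQ.mem_dom_del.mpr hi))
    by_cases hxt : hQ.top x = x
    · have h0 := hQ.rank_top hxt
      refine ⟨fun h => absurd h (by omega), fun _ => ?_⟩
      refine hQ.app_of_top_eq (hQ.del_mem i) hxt (hQ.mem_dom_del.mpr ?_)
      rintro rfl
      exact hi hxt
    · obtain ⟨y, hy, -, hyt⟩ := hQ.exists_succ hxt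
      have hry := hQ.rank_succ hy
      rw [hx] at hy
      -- Here y is the successor of x. The induction hypothesis evaluates the right side, and
      -- injectivity of `del (top i)` then recovers the value of `del i` at x.
      have hc : (hQ.del i * hQ.del (hQ.top i)).app x = (hQ.del k).app y := by
        rw [hcomm, mul_app_of _ hy]
      obtain ⟨ih1, ih2⟩ := ih (i := k) (x := y) (hyt.trans (hx.trans hkt.symm)) hrk
      constructor
      · intro h
        have hyt' : hQ.top y ≠ y := hQ.top_ne_of_rank_pos (by omega)
        obtain ⟨z, hz, -⟩ := hQ.exists_succ hyt'
        rw [hyt, hx] at hz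
        rw [ih1 (by omega), hkt, hz] at hc
        obtain ⟨w, hw, hwz⟩ := mul_app_some.mp hc
        rw [hw, hy, app_inj hwz hz]
      · intro h
        rw [ih2 (by omega)] at hc
        obtain ⟨w, hw, hwz⟩ := mul_app_some.mp hc
        rw [hw, app_inj hwz hy]

/-- The decomposition into the sets of points with the same top, ordered towards the top. -/
noncomputable def decomposition [Finite X] (hQ : IsDomTransversal Q) : OrderedDecomposition X where
  k := Nat.card (Set.range hQ.top)
  block i := {x | hQ.top x = (Finite.equivFin (Set.range hQ.top)).symm i}
  nonempty i := by
    obtain ⟨x, hx⟩ := ((Finite.equivFin (Set.range hQ.top)).symm i).2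
    exact ⟨x, hx⟩
  disjoint i j hij := by
    rw [Set.disjoint_left]
    intro x hi hj
    exact hij ((Finite.equivFin (Set.range hQ.top)).symm.injective
      (Subtype.ext (Eq.trans (Eq.symm hi) hj)))
  cover x := ⟨Finite.equivFin _ ⟨_, x, rfl⟩, by rw [Set.mem_ofPred_eq, Equiv.symm_apply_apply]⟩
  order i := LinearOrder.lift' (fun x => OrderDual.toDual (hQ.rank x.1)) fun x y h =>
    Subtype.ext (hQ.rank_inj (Eq.trans x.2 (Eq.symm y.2)) h)

theorem top_eq_of_mem_block [Finite X] (hQ : IsDomTransversal Q) {x y : X}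
    {i : Fin hQ.decomposition.k} (hx : x ∈ hQ.decomposition.block i)
    (hy : y ∈ hQ.decomposition.block i) : hQ.top x = hQ.top y := Eq.trans hx (Eq.symm hy)

theorem del_eq_glueAct [Finite X] (hQ : IsDomTransversal Q) (j : Fin hQ.decomposition.k)
    (i : hQ.decomposition.block j) :
    hQ.del i = hQ.decomposition.glueAct (Function.update (fun _ => 1) j
      (@chain _ (hQ.decomposition.order j) i)) := by
  have htop : ∀ {l} (x : hQ.decomposition.block l), hQ.top x.1 = hQ.top i.1 ↔ l = j := by
    intro l x
    have hx : hQ.top x.1 = _ := x.2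
    have hi : hQ.top i.1 = _ := i.2
    rw [hx, hi]
    exact Subtype.val_inj.trans (Equiv.apply_eq_iff_eq _)
  apply ext
  intro x
  obtain ⟨l, x, rfl⟩ := hQ.decomposition.exists_block x
  rw [OrderedDecomposition.glueAct_app]
  by_cases hl : l = j
  · subst hl
    rw [Function.update_self]
    let _ := hQ.decomposition.order l
    -- The block order reverses rank, so the top is the largest element.
    have hlt : ∀ p q : hQ.decomposition.block l, p < q ↔ hQ.rank q < hQ.rank p := fun _ _ => Iff.rfl
    have hx := (htop x).mpr rfl
    rcases lt_trichotomy (hQ.rank i.1) (hQ.rank x.1) with h | h | h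
    · rw [(hQ.del_app hx).1 h, ← hx]
      obtain ⟨y, hy, -, hyt⟩ := hQ.exists_succ (hQ.top_ne_of_rank_pos (Nat.zero_lt_of_lt h))
      have hr := hQ.rank_succ hy
      have hxy : x ⋖ (⟨y, hyt.trans x.2⟩ : hQ.decomposition.block l) := by
        refine ⟨(hlt _ _).mpr (by simp only; omega), fun z h1 h2 => ?_⟩
        rw [hlt] at h1 h2
        simp only at h1 h2
        omega
      rw [hy, chain_app.mpr (Or.inl ⟨(hlt _ _).mpr h, hxy⟩), Option.map_some]
    · obtain rfl : x = i := Subtype.ext (hQ.rank_inj hx h.symm)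
      rw [del_self, chain_app_self, Option.map_none]
    · rw [(hQ.del_app hx).2 h, chain_app.mpr (Or.inr ⟨(hlt _ _).mpr h, rfl⟩), Option.map_some]
  · rw [Function.update_of_ne hl, one_app, Option.map_some,
      hQ.del_app_of_top_ne fun h => hl ((htop x).mp h)]

/-- The intersection contains all single-point deletions, hence an element for every domain;
transversality of each side leaves no room for anything else. -/
theorem eq_prodAct [Finite X] (hQ : IsDomTransversal Q) : Q = hQ.decomposition.prodAct := by
  have hP := hQ.decomposition.isDomTransversal_prodAct
  have key : ∀ i, ∃ a ∈ Q ⊓ hQ.decomposition.prodAct, a.dom = {i}ᶜ := by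
    intro i
    obtain ⟨j, i, rfl⟩ := hQ.decomposition.exists_block i
    refine ⟨hQ.del i, ⟨hQ.del_mem i, _, fun l => ?_, (hQ.del_eq_glueAct j i).symm⟩, hQ.dom_elt _⟩
    by_cases hl : l = j
    · subst hl
      rw [Function.update_self]
      exact Submonoid.subset_closure ⟨i, rfl⟩
    · rw [Function.update_of_ne hl]
      exact Submonoid.one_mem (Submonoid.closure _)
  ext a
  obtain ⟨b, hb, hba⟩ := exists_mem_dom_eq key a.dom
  constructor
  · intro ha
    exact hQ.eq_of_dom ha hb.1 hba.symm ▸ hb.2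
  · intro ha
    exact hP.eq_of_dom ha hb.2 hba.symm ▸ hb.1

end IsDomTransversal

end ISym

/-! ### Green's relation in the partial wreath product -/

namespace PWreath

variable {S : Type v} {X : Type u}

theorem mem_dom_act {w : PWreath S X} {x : X} : x ∈ w.act.dom ↔ ∃ s, w.fn x = some s := by
  rw [ISym.mem_dom_isSome, ← w.dom_eq, Option.isSome_iff_exists]

theorem mul_fn_some [Mul S] {w z : PWreath S X} {x : X} {r : S} :
    (w * z).fn x = some r ↔ ∃ s t y, w.fn x = some s ∧ w.act.app x = some y ∧
      z.fn y = some t ∧ s * t = r := by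
  rw [mul_fn, pmul, Option.map₂_eq_some_iff]
  constructor
  · rintro ⟨s, t, hs, ht, h⟩
    obtain ⟨y, hy, ht⟩ := Option.bind_eq_some_iff.mp ht
    exact ⟨s, t, y, hs, hy, ht, h⟩
  · rintro ⟨s, t, y, hs, hy, ht, h⟩
    exact ⟨s, t, hs, Option.bind_eq_some_iff.mpr ⟨y, hy, ht⟩, h⟩

/-- The element `(f, a)` for a total function `f`, restricted to the domain of `a`. -/
def tot (f : X → S) (a : ISym X) : PWreath S X where
  fn x := (a.app x).map fun _ => f x
  act := a
  dom_eq _ := Option.isSome_map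

theorem tot_fn {f : X → S} {a : ISym X} {x y : X} (h : a.app x = some y) :
    (tot f a).fn x = some (f x) := by
  simp only [tot, h, Option.map_some]

theorem tot_congr {f g : X → S} {a : ISym X} (h : ∀ x ∈ a.dom, f x = g x) :
    tot f a = tot g a := by
  refine PWreath.ext ?_ rfl
  funext x
  by_cases hx : x ∈ a.dom
  · obtain ⟨y, hy⟩ := hx
    rw [tot_fn hy, tot_fn hy, h x ⟨y, hy⟩]
  · simp only [tot, ISym.app_eq_none hx, Option.map_none]

theorem eq_of_tot_eq {f g : X → S} {a b : ISym X} (h : tot f a = tot g b) {x : X}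
    (hx : x ∈ a.dom) : f x = g x := by
  obtain rfl : a = b := congrArg act h
  obtain ⟨y, hy⟩ := hx
  have := congrArg (fun w => w.fn x) h
  simp only [tot_fn hy] at this
  exact Option.some.inj this

/-- Reduces computations to total functions; the filler c off the domain has no effect. -/
theorem eq_tot (w : PWreath S X) (c : S) : w = tot (fun x => (w.fn x).getD c) w.act := by
  refine PWreath.ext ?_ rfl
  funext x
  cases h : w.fn x with
  | none =>
    have hx : x ∉ w.act.dom := fun hx => by
      obtain ⟨s, hs⟩ := mem_dom_act.mp hx
      rw [h] at hs
      cases hs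
    simp only [tot, ISym.app_eq_none hx, Option.map_none]
  | some s =>
    obtain ⟨y, hy⟩ : x ∈ w.act.dom := mem_dom_act.mpr ⟨s, h⟩
    rw [tot_fn hy, h, Option.getD_some]

theorem tot_mul [Mul S] {f g h : X → S} {a b c : ISym X} (hc : a * b = c)
    (hh : ∀ x y, a.app x = some y → y ∈ b.dom → f x * g y = h x) :
    tot f a * tot g b = tot h c := by
  subst hc
  refine PWreath.ext ?_ rfl
  funext x
  apply Option.ext
  intro r
  rw [mul_fn_some]
  constructor
  · rintro ⟨s, t, y, hs, hy, ht, rfl⟩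
    obtain ⟨z, hz⟩ : y ∈ b.dom := mem_dom_act (w := tot g b).mpr ⟨t, ht⟩
    change a.app x = some y at hy
    rw [tot_fn hy] at hs
    rw [tot_fn hz] at ht
    rw [tot_fn (ISym.mul_app_some.mpr ⟨y, hy, hz⟩), ← hh x y hy ⟨z, hz⟩, Option.some.inj hs,
      Option.some.inj ht]
  · intro hr
    obtain ⟨z, hz⟩ : x ∈ (a * b).dom := mem_dom_act (w := tot h (a * b)).mpr ⟨r, hr⟩
    rw [tot_fn hz] at hr
    obtain ⟨y, hy, hz⟩ := ISym.mul_app_some.mp hz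
    exact ⟨f x, g y, y, tot_fn hy, hy, tot_fn hz, (hh x y hy ⟨z, hz⟩).trans (Option.some.inj hr)⟩

instance [Monoid S] : Monoid (PWreath S X) where
  one := tot 1 1
  one_mul w := by
    rw [eq_tot w 1]
    exact tot_mul (one_mul _) fun x y hy _ => by
      rw [← Option.some.inj hy, Pi.one_apply, one_mul]
  mul_one w := by
    rw [eq_tot w 1]
    exact tot_mul (mul_one _) fun x y hy _ => by rw [Pi.one_apply, mul_one]

theorem exists_tot_mul_eq [Mul S] {f g : X → S} {a b : ISym X} :
    (∃ h, tot f a * h = tot g b) ↔ b.dom ⊆ a.dom ∧ ∀ x ∈ b.dom, ∃ k, f x * k = g x := by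
  constructor
  · rintro ⟨h, e⟩
    have key : ∀ x ∈ b.dom, x ∈ a.dom ∧ ∃ k, f x * k = g x := by
      rintro x ⟨z, hz⟩
      have hx := tot_fn (f := g) hz
      rw [← e, mul_fn_some] at hx
      obtain ⟨s, t, y, hs, hy, ht, hst⟩ := hx
      rw [tot_fn (a := a) hy] at hs
      exact ⟨⟨y, hy⟩, t, by rw [Option.some.inj hs, hst]⟩
    exact ⟨fun x hx => (key x hx).1, fun x hx => (key x hx).2⟩
  · rintro ⟨hdom, h⟩
    -- The right factor is indexed by the image points of a. Injectivity of a makes these choices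
    -- independent; at other points any value will do.
    have : ∀ y, ∃ t, ∀ x, a.app x = some y → x ∈ b.dom → f x * t = g x := by
      intro y
      by_cases hy : ∃ x, a.app x = some y ∧ x ∈ b.dom
      · obtain ⟨x, hx, hxb⟩ := hy
        obtain ⟨t, ht⟩ := h x hxb
        exact ⟨t, fun x' hx' _ => ISym.app_inj hx hx' ▸ ht⟩
      · by_cases hS : Nonempty S
        · exact ⟨hS.some, fun x hx hxb => absurd ⟨x, hx, hxb⟩ hy⟩
        · by_cases hX : ∃ x, a.app x = some y
          · obtain ⟨x, -⟩ := hX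
            exact absurd ⟨f x⟩ hS
          · exact absurd ⟨f y⟩ hS
    choose t ht using this
    refine ⟨tot t (a.inv * b), tot_mul ?_ ?_⟩
    · apply ISym.ext
      intro x
      by_cases hx : x ∈ a.dom
      · obtain ⟨y, hy⟩ := hx
        rw [ISym.mul_app_of _ hy, ISym.mul_app_of _ (ISym.inv_app.mpr hy)]
      · rw [ISym.app_eq_none fun hx' => hx (hdom hx'),
          ISym.app_eq_none fun hx' => hx (ISym.dom_mul_subset _ _ hx')]
    · intro x y hy hyb
      obtain ⟨x', hx', hb⟩ := ISym.mem_dom_mul.mp hyb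
      obtain rfl := ISym.app_inj hy (ISym.inv_app.mp hx')
      exact ht y x hy hb

theorem greenR_tot [Monoid S] {f g : X → S} {a b : ISym X} :
    GreenR (tot f a) (tot g b) ↔ a.dom = b.dom ∧ ∀ x ∈ a.dom, GreenR (f x) (g x) := by
  rw [greenR_iff, exists_tot_mul_eq, exists_tot_mul_eq]
  simp only [greenR_iff]
  constructor
  · rintro ⟨⟨h1, h2⟩, h3, h4⟩
    exact ⟨h3.antisymm h1, fun x hx => ⟨h2 x (h3 hx), h4 x hx⟩⟩
  · rintro ⟨h, h'⟩
    exact ⟨⟨h.ge, fun x hx => (h' x (h.ge hx)).1⟩, h.le, fun x hx => (h' x hx).2⟩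

theorem isRCrossSection_of_mem_iff [Monoid S] {Q : Submonoid (ISym X)}
    (hQ : ISym.IsDomTransversal Q) {R : X → Subsemigroup S} (hR : ∀ x, IsRCrossSection (R x))
    {T : Subsemigroup (PWreath S X)}
    (hT : ∀ f a, tot f a ∈ T ↔ a ∈ Q ∧ ∀ x ∈ a.dom, f x ∈ R x) : IsRCrossSection T := by
  apply isRCrossSection_of
  · intro w
    rw [eq_tot w 1]
    choose r hr hr' using fun x => (hR x).exists_mem ((w.fn x).getD 1)
    refine ⟨tot r (hQ.elt w.act.dom), (hT _ _).mpr ⟨hQ.elt_mem _, fun x _ => hr x⟩, ?_⟩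
    exact greenR_tot.mpr ⟨(hQ.dom_elt _).symm, fun x _ => hr' x⟩
  · intro w hw z hz
    rw [eq_tot w 1] at hw ⊢
    rw [eq_tot z 1] at hz ⊢
    intro h
    rw [hT] at hw hz
    obtain ⟨h1, h2⟩ := greenR_tot.mp h
    rw [hQ.eq_of_dom hw.1 hz.1 h1]
    exact tot_congr fun x hx => (hR x).eq_of_greenR (hw.2 x (h1.ge hx)) (hz.2 x hx)
      (h2 x (h1.ge hx))

end PWreath

/-! ### Membership in the standard products -/

namespace OrderedDecomposition

variable {S : Type v} {X : Type u} [Semigroup S] (D : OrderedDecomposition X)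

theorem glue_act (p : ∀ i, PWreath S (D.block i)) :
    (D.glue p).act = D.glueAct fun i => (p i).act := rfl

theorem glue_fn (p : ∀ i, PWreath S (D.block i)) (i : Fin D.k) (x : D.block i) :
    (D.glue p).fn x = (p i).fn x := D.glueFn_apply (fun i => (p i).fn) i x

theorem mem_prodIn_factorR (R : Fin D.k → Subsemigroup S) (w : PWreath S X) :
    w ∈ D.prodIn (D.factorR R) ↔ w.act ∈ D.prodAct ∧
      ∀ x s, w.fn x = some s → s ∈ R (D.idx x) := by
  constructor
  · rintro ⟨p, hp, rfl⟩
    refine ⟨⟨_, fun i => (hp i).1, rfl⟩, fun x s hx => ?_⟩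
    obtain ⟨i, x, rfl⟩ := D.exists_block x
    rw [D.idx_eq x.2]
    rw [glue_fn] at hx
    exact (hp i).2 x s hx
  · rintro ⟨⟨a, ha, haw⟩, hw⟩
    refine ⟨fun i => ⟨fun x => w.fn x, a i, fun x => ?_⟩, fun i => ⟨ha i, fun x s hx => ?_⟩, ?_⟩
    · rw [w.dom_eq, ← haw, glueAct_app, Option.isSome_map]
    · rw [← D.idx_eq x.2]
      exact hw x s hx
    · refine PWreath.ext ?_ haw
      funext x
      obtain ⟨i, x, rfl⟩ := D.exists_block x
      rw [glue_fn]

theorem tot_mem_prodIn_factorR (R : Fin D.k → Subsemigroup S) (f : X → S) (a : ISym X) :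
    PWreath.tot f a ∈ D.prodIn (D.factorR R) ↔
      a ∈ D.prodAct ∧ ∀ x ∈ a.dom, f x ∈ R (D.idx x) := by
  rw [mem_prodIn_factorR]
  refine and_congr_right fun _ => ⟨?_, ?_⟩
  · rintro h x ⟨y, hy⟩
    exact h x _ (PWreath.tot_fn hy)
  · intro h x s hs
    obtain ⟨y, hy⟩ : x ∈ a.dom := PWreath.mem_dom_act (w := PWreath.tot f a).mpr ⟨s, hs⟩
    rw [PWreath.tot_fn hy] at hs
    exact Option.some.inj hs ▸ h x ⟨y, hy⟩

end OrderedDecomposition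

theorem isRCrossSection_prodIn {S : Type v} {X : Type u} [Monoid S] [Finite X]
    (D : OrderedDecomposition X) {R : Fin D.k → Subsemigroup S}
    (hR : ∀ i, IsRCrossSection (R i)) : IsRCrossSection (D.prodIn (D.factorR R)) :=
  PWreath.isRCrossSection_of_mem_iff D.isDomTransversal_prodAct (fun x => hR (D.idx x))
    (D.tot_mem_prodIn_factorR R)

/-! ### Cross-sections of the partial wreath product -/

namespace IsRCrossSection

open PWreath

variable {S : Type v} {X : Type u} [MonoidWithZero S] {T : Subsemigroup (PWreath S X)}

theorem exists_tot_mem (hT : IsRCrossSection T) (f : X → S) (a : ISym X) :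
    ∃ g b, tot g b ∈ T ∧ a.dom = b.dom ∧ ∀ x ∈ a.dom, GreenR (f x) (g x) := by
  obtain ⟨t, ht, h⟩ := hT.exists_mem (tot f a)
  rw [eq_tot t 1] at ht h
  exact ⟨_, _, ht, greenR_tot.mp h⟩

theorem exists_zero_mem (hT : IsRCrossSection T) (a : ISym X) :
    ∃ b : ISym X, tot 0 b ∈ T ∧ b.dom = a.dom := by
  obtain ⟨g, b, hb, hab, h⟩ := hT.exists_tot_mem 0 a
  exact ⟨b, tot_congr (f := g) (g := 0) (fun x hx => (h x (hab.ge hx)).eq_zero) ▸ hb, hab.symm⟩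

theorem zero_eq_of_dom (hT : IsRCrossSection T) {a b : ISym X} (ha : tot 0 a ∈ T)
    (hb : tot 0 b ∈ T) (h : a.dom = b.dom) : a = b :=
  congrArg act (hT.eq_of_greenR ha hb (greenR_tot.mpr ⟨h, fun _ _ => GreenR.refl _⟩))

theorem zero_mul_mem {a b : ISym X} (ha : tot 0 a ∈ T) (hb : tot 0 b ∈ T) :
    tot 0 (a * b) ∈ T :=
  tot_mul (f := (0 : X → S)) (g := (0 : X → S)) (h := (0 : X → S)) (a := a) (b := b) rfl
    (fun _ _ _ _ => zero_mul _) ▸ mul_mem ha hb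

theorem dom_one : (1 : ISym X).dom = Set.univ :=
  Set.eq_univ_of_forall fun x => ⟨x, ISym.one_app x⟩

/-- The element of T with zero values and full domain has an idempotent action, because its square
has the same domain; the action is therefore the identity. -/
theorem zero_one_mem (hT : IsRCrossSection T) : tot 0 1 ∈ T := by
  obtain ⟨b, hb, hdom⟩ := hT.exists_zero_mem 1
  rw [dom_one] at hdom
  have hbb : b * b = b := by
    apply hT.zero_eq_of_dom (zero_mul_mem hb hb) hb
    ext x
    rw [ISym.mem_dom_mul]
    simp only [hdom, Set.mem_univ, and_true, iff_true]
    exact (hdom ▸ Set.mem_univ x : x ∈ b.dom)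
  rwa [ISym.eq_one_of_mul_self hdom hbb] at hb

/-- The partial bijections that occur in the elements of `T`. -/
def acts (hT : IsRCrossSection T) : Submonoid (ISym X) where
  carrier := {a | tot 0 a ∈ T}
  one_mem' := hT.zero_one_mem
  mul_mem' := zero_mul_mem

theorem isDomTransversal_acts (hT : IsRCrossSection T) : ISym.IsDomTransversal hT.acts := by
  intro A
  obtain ⟨b, hb, h⟩ := hT.exists_zero_mem
    (ISym.ofRel (fun x y => x = y ∧ x ∈ A) (by rintro x _ _ ⟨rfl, -⟩ ⟨rfl, -⟩; rfl)
      (by rintro x y _ ⟨rfl, -⟩ ⟨rfl, -⟩; rfl))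
  have hA : b.dom = A := by
    rw [h]
    ext x
    simp only [ISym.mem_dom, ISym.ofRel_app, exists_eq_left']
  refine ⟨b, ⟨hb, hA⟩, fun c hc => hT.zero_eq_of_dom hc.1 hb (hc.2.trans hA.symm)⟩

theorem act_mem_acts (hT : IsRCrossSection T) {f : X → S} {a : ISym X} (h : tot f a ∈ T) :
    a ∈ hT.acts := by
  have e : tot f a * tot 0 1 = tot 0 a := tot_mul (mul_one a) fun _ _ _ _ => mul_zero _
  exact (e ▸ mul_mem h hT.zero_one_mem : tot 0 a ∈ T)

theorem exists_tot_mem_acts (hT : IsRCrossSection T) (f : X → S) {a : ISym X} (ha : a ∈ hT.acts) :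
    ∃ g, tot g a ∈ T ∧ ∀ x ∈ a.dom, GreenR (f x) (g x) := by
  obtain ⟨g, b, hg, hab, h⟩ := hT.exists_tot_mem f a
  obtain rfl := hT.isDomTransversal_acts.eq_of_dom ha (hT.act_mem_acts hg) hab
  exact ⟨g, hg, h⟩

theorem eq_of_tot_mem (hT : IsRCrossSection T) {f g : X → S} {a : ISym X} (hf : tot f a ∈ T)
    (hg : tot g a ∈ T) (h : ∀ x ∈ a.dom, GreenR (f x) (g x)) {x : X} (hx : x ∈ a.dom) :
    f x = g x :=
  eq_of_tot_eq (hT.eq_of_greenR hf hg (greenR_tot.mpr ⟨rfl, h⟩)) hx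

theorem greenR_units (p q : Sˣ) : GreenR (p : S) (q : S) := by
  have h := fun r : Sˣ => GreenR.mul_unit (1 : S) r.mul_inv
  simp only [one_mul] at h
  exact (h p).trans (h q).symm

/-- In the finite monoid S the R-class of 1 is the group of units, so the representative of (1, a)
has unit values. -/
theorem exists_units_mem [Finite S] (hT : IsRCrossSection T) {a : ISym X} (ha : a ∈ hT.acts) :
    ∃ c : X → Sˣ, tot (fun x => (c x : S)) a ∈ T := by
  obtain ⟨g, hg, h⟩ := hT.exists_tot_mem_acts 1 ha
  have : ∀ x, ∃ c : Sˣ, x ∈ a.dom → g x = c := by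
    intro x
    by_cases hx : x ∈ a.dom
    · obtain ⟨c, hc⟩ := GreenR.one_iff.mp (h x hx)
      exact ⟨c, fun _ => hc.symm⟩
    · exact ⟨1, fun h => absurd h hx⟩
  choose c hc using this
  exact ⟨c, tot_congr hc ▸ hg⟩

/-- The unit that occurs at the point `x` in an element with domain `{x}`. -/
theorem exists_transition [Finite S] (hT : IsRCrossSection T) :
    ∃ d : X → Sˣ, ∀ x, ∀ c : X → Sˣ,
      tot (fun y => (c y : S)) (hT.isDomTransversal_acts.elt {x}) ∈ T → c x = d x := by
  have hQ := hT.isDomTransversal_acts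
  choose c hc using fun x => hT.exists_units_mem (hQ.elt_mem {x})
  refine ⟨fun x => c x x, fun x b hb => ?_⟩
  have := hT.eq_of_tot_mem hb (hc x) (fun y _ => greenR_units _ _) (x := x)
    ((hQ.dom_elt {x}).ge rfl)
  exact Units.val_inj.mp this

/-- Multiplying (c, a) by the unit-valued element over {y} gives the one over {x}, whose unit at x
is d x. -/
theorem units_mul_transition [Finite S] (hT : IsRCrossSection T) {d : X → Sˣ}
    (hd : ∀ x, ∀ c : X → Sˣ,
      tot (fun y => (c y : S)) (hT.isDomTransversal_acts.elt {x}) ∈ T → c x = d x)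
    {a : ISym X} (ha : a ∈ hT.acts) {c : X → Sˣ} (hc : tot (fun y => (c y : S)) a ∈ T) {x y : X}
    (h : a.app x = some y) : c x * d y = d x := by
  have hQ := hT.isDomTransversal_acts
  obtain ⟨b, hb⟩ := hT.exists_units_mem (hQ.elt_mem {y})
  rw [← hd y b hb]
  refine hd x (fun z => c z * b y) ?_
  rw [← tot_mul (f := fun z => (c z : S)) (g := fun z => (b z : S)) (hQ.mul_elt_singleton ha h)]
  · exact mul_mem hc hb
  · intro z w _ hw
    rw [hQ.dom_elt, Set.mem_singleton_iff] at hw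
    rw [hw, Units.val_mul]

/-! ### Diagonal elements of a cross-section and their values at a point -/

variable [DecidableEq X]

theorem single_mul_single (x : X) (s t : S) :
    tot (Pi.single x s) 1 * tot (Pi.single x t) 1 = tot (Pi.single x (s * t)) (1 : ISym X) := by
  refine tot_mul (one_mul 1) fun z y hy _ => ?_
  obtain rfl := Option.some.inj hy
  by_cases hx : z = x
  · subst hx
    simp only [Pi.single_eq_same]
  · simp only [Pi.single_eq_of_ne hx, mul_zero]

/-- The elements of `S` that occur at the point `x` in the elements of `T`. -/
def valuesAt (T : Subsemigroup (PWreath S X)) (x : X) : Subsemigroup S where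
  carrier := {s | tot (Pi.single x s) 1 ∈ T}
  mul_mem' {s t} hs ht := by
    rw [Set.mem_ofPred_eq, ← single_mul_single]
    exact mul_mem hs ht

theorem mem_valuesAt {x : X} {s : S} : s ∈ valuesAt T x ↔ tot (Pi.single x s) 1 ∈ T := Iff.rfl

theorem exists_single_mem (hT : IsRCrossSection T) (x : X) (s : S) :
    ∃ t ∈ valuesAt T x, GreenR s t := by
  obtain ⟨g, hg, h⟩ := hT.exists_tot_mem_acts (Pi.single x s) (one_mem _)
  rw [dom_one] at h
  refine ⟨g x, ?_, ?_⟩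
  · have : tot g 1 = tot (Pi.single x (g x)) 1 := by
      refine tot_congr fun y _ => ?_
      by_cases hy : y = x
      · subst hy
        rw [Pi.single_eq_same]
      · have := h y (Set.mem_univ y)
        rw [Pi.single_eq_of_ne hy] at this ⊢
        exact this.eq_zero
    exact mem_valuesAt.mpr (this ▸ hg)
  · have := h x (Set.mem_univ x)
    rwa [Pi.single_eq_same] at this

theorem isRCrossSection_valuesAt (hT : IsRCrossSection T) (x : X) :
    IsRCrossSection (valuesAt T x) := by
  refine isRCrossSection_of (hT.exists_single_mem x) fun s hs t ht h => ?_
  have := hT.eq_of_tot_mem hs ht (fun y _ => ?_) (x := x) (dom_one ▸ Set.mem_univ x)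
  · simpa only [Pi.single_eq_same] using this
  · by_cases hy : y = x
    · subst hy
      simpa only [Pi.single_eq_same] using h
    · simp only [Pi.single_eq_of_ne hy]
      exact GreenR.refl _

theorem one_mem_of_finite {H : Type v} [Monoid H] [Finite H] {R : Subsemigroup H}
    (hR : IsRCrossSection R) : 1 ∈ R := by
  obtain ⟨t, ht, h⟩ := hR.exists_mem 1
  obtain ⟨c, rfl⟩ := GreenR.one_iff.mp h
  have h' : GreenR ((c : H) * c) c := GreenR.mul_unit _ c.mul_inv
  have := hR.eq_of_greenR (mul_mem ht ht) ht h'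
  rw [← Units.val_mul, Units.val_inj, mul_eq_left] at this
  rwa [this] at ht

theorem app_mem_valuesAt [Finite S] (hT : IsRCrossSection T) {f : X → S} (h : tot f 1 ∈ T)
    (x : X) : f x ∈ valuesAt T x := by
  have h1 := mem_valuesAt.mp (hT.isRCrossSection_valuesAt x).one_mem_of_finite
  have h2 : tot f 1 * tot (Pi.single x 1) 1 = tot (Pi.single x (f x)) (1 : ISym X) := by
    refine tot_mul (one_mul 1) fun z y hy _ => ?_
    obtain rfl := Option.some.inj hy
    by_cases hx : z = x
    · subst hx
      simp only [Pi.single_eq_same, mul_one]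
    · simp only [Pi.single_eq_of_ne hx, mul_zero]
  exact mem_valuesAt.mpr (h2 ▸ mul_mem h h1)

theorem tot_one_mem [Finite S] (hT : IsRCrossSection T) {f : X → S}
    (h : ∀ x, f x ∈ valuesAt T x) : tot f 1 ∈ T := by
  obtain ⟨g, hg, hfg⟩ := hT.exists_tot_mem_acts f (one_mem _)
  rwa [tot_congr fun x hx => (hT.isRCrossSection_valuesAt x).eq_of_greenR (h x)
    (hT.app_mem_valuesAt hg x) (hfg x hx)]

/-- Let g ∈ R_x represent (c x) r. Both (c x) r and g (c x) occur over the domain {x} in T and are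
R-equivalent, hence equal, so g = (c x) r (c x)⁻¹. -/
theorem conj_mem_valuesAt [Finite S] (hT : IsRCrossSection T) {d : X → Sˣ}
    (hd : ∀ x, ∀ c : X → Sˣ,
      tot (fun y => (c y : S)) (hT.isDomTransversal_acts.elt {x}) ∈ T → c x = d x)
    {x : X} {r : S} (hr : r ∈ valuesAt T (hT.isDomTransversal_acts.top x)) :
    (d x : S) * r * ↑(d x)⁻¹ ∈ valuesAt T x := by
  have hQ := hT.isDomTransversal_acts
  obtain ⟨c, hc⟩ := hT.exists_units_mem (hQ.elt_mem {x})
  rw [← hd x c hc]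
  obtain ⟨g, hg, h⟩ := hT.exists_single_mem x (c x * r)
  have hdom := hQ.dom_elt {x}
  have h1 : tot (fun _ => c x * r) (hQ.elt {x}) ∈ T := by
    rw [← tot_mul (f := fun y => (c y : S)) (g := Pi.single (hQ.top x) r)
      (mul_one (hQ.elt {x}))]
    · exact mul_mem hc (mem_valuesAt.mp hr)
    · intro z y hz _
      have hzx : z ∈ (hQ.elt {x}).dom := ⟨y, hz⟩
      rw [hdom, Set.mem_singleton_iff] at hzx
      subst hzx
      rw [hQ.elt_singleton] at hz
      rw [← Option.some.inj hz, Pi.single_eq_same]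
  have h2 : tot (fun _ => g * c x) (hQ.elt {x}) ∈ T := by
    rw [← tot_mul (f := Pi.single x g) (g := fun y => (c y : S)) (one_mul (hQ.elt {x}))]
    · exact mul_mem (mem_valuesAt.mp hg) hc
    · intro z y hz hy
      obtain rfl := Option.some.inj hz
      rw [hdom, Set.mem_singleton_iff] at hy
      rw [hy, Pi.single_eq_same]
  have h3 := hT.eq_of_tot_mem h1 h2 (fun _ _ => h.trans (GreenR.mul_unit g (c x).mul_inv).symm)
    (hdom.ge (Set.mem_singleton x))
  rw [h3, mul_assoc, Units.mul_inv, mul_one]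
  exact hg

theorem exists_mulEquiv [Finite S] [Finite X] (hT : IsRCrossSection T) :
    ∃ (D : OrderedDecomposition X) (R : Fin D.k → Subsemigroup S),
      (∀ i, IsRCrossSection (R i)) ∧ Nonempty (T ≃* (∀ i, D.factorR R i)) := by
  have hQ := hT.isDomTransversal_acts
  obtain ⟨d, hd⟩ := hT.exists_transition
  let D := hQ.decomposition
  -- The chosen point only serves to name the top of the block.
  let R : Fin D.k → Subsemigroup S := fun i => valuesAt T (hQ.top (D.nonempty i).some)
  have hR : ∀ i, IsRCrossSection (R i) := fun i => hT.isRCrossSection_valuesAt _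
  have hRx : ∀ x, R (D.idx x) = valuesAt T (hQ.top x) := fun x => by
    rw [← hQ.top_eq_of_mem_block (D.nonempty (D.idx x)).some_mem (D.mem_idx x)]
  refine ⟨D, R, hR, ?_⟩
  let C : PWreath S X := tot (fun x => (d x : S)) 1
  let C' : PWreath S X := tot (fun x => ((d x)⁻¹ : Sˣ)) 1
  have hCC' : C * C' = 1 := tot_mul (one_mul 1) fun x y hy _ => by
    rw [← Option.some.inj hy, Units.mul_inv, Pi.one_apply]
  have hC'C : C' * C = 1 := tot_mul (one_mul 1) fun x y hy _ => by
    rw [← Option.some.inj hy, Units.inv_mul, Pi.one_apply]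
  have hmem : ∀ w ∈ D.prodIn (D.factorR R), C * w * C' ∈ T := by
    intro w hw
    rw [D.mem_prodIn_factorR, ← hQ.eq_prodAct] at hw
    obtain ⟨ha, hf⟩ := hw
    have hf' : ∀ x, (w.fn x).getD 1 ∈ valuesAt T (hQ.top x) := by
      intro x
      cases h : w.fn x with
      | none => exact (hT.isRCrossSection_valuesAt _).one_mem_of_finite
      | some s => exact hRx x ▸ hf x s h
    have hw := eq_tot w 1
    obtain ⟨c, hc⟩ := hT.exists_units_mem ha
    have hg := hT.tot_one_mem fun x => hT.conj_mem_valuesAt hd (hf' x)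
    have hprod := mul_mem hg hc
    have h1 : C * w = tot (fun x => (d x : S) * (w.fn x).getD 1) w.act := by
      conv_lhs => rw [hw]
      exact tot_mul (one_mul _) fun x y hy _ => by rw [← Option.some.inj hy]
    -- The conjugate of w splits into a diagonal element of T and a unit-valued one; c x · d y = d x
    -- cancels the twist.
    have h2 : tot (fun x => (d x : S) * (w.fn x).getD 1 * ↑(d x)⁻¹) 1 *
        tot (fun x => (c x : S)) w.act * C = C * w := by
      rw [h1, tot_mul (h := fun x => (d x : S) * (w.fn x).getD 1 * ↑(d x)⁻¹ * c x) (one_mul _)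
        fun x y hy _ => by rw [← Option.some.inj hy]]
      refine tot_mul (mul_one _) fun x y hy _ => ?_
      rw [mul_assoc _ (c x : S), ← Units.val_mul, hT.units_mul_transition hd ha hc hy, mul_assoc,
        Units.inv_mul, mul_one]
    rw [← h2, mul_assoc, hCC', mul_one]
    exact hprod
  have hsurj : ∀ t ∈ T, ∃ w ∈ D.prodIn (D.factorR R), C * w * C' = t := by
    intro t ht
    -- The product is itself a cross-section, so some w in it is R-equivalent to C⁻¹t. Then CwC⁻¹
    -- lies in T and is R-equivalent to t.
    obtain ⟨w, hw, h⟩ := (isRCrossSection_prodIn D hR).exists_mem (C' * t)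
    refine ⟨w, hw, (hT.eq_of_greenR ht (hmem w hw) ?_).symm⟩
    have h' := h.mul_left C
    rw [← mul_assoc, hCC', one_mul] at h'
    exact h'.trans (GreenR.mul_unit _ hC'C).symm
  let φ : (∀ i, D.factorR R i) →ₙ* T :=
    { toFun := fun p => ⟨C * D.glue (fun i => (p i : PWreath S (D.block i))) * C',
        hmem _ ⟨_, fun i => (p i).2, rfl⟩⟩
      map_mul' := by
        intro p q
        apply Subtype.ext
        have e : D.glue (fun i => ((p * q) i : PWreath S (D.block i))) =
          D.glue (fun i => (p i : PWreath S (D.block i))) * D.glue (fun i => (q i : _)) :=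
          map_mul D.glue _ _
        rw [MulMemClass.mk_mul_mk]
        simp only [e]
        rw [show ∀ P P' : PWreath S X, C * P * C' * (C * P' * C') = C * P * (C' * C) * P' * C' from
          fun P P' => by simp only [mul_assoc], hC'C, mul_one]
        simp only [mul_assoc] }
  refine ⟨(MulEquiv.ofBijective φ ⟨fun p q h => ?_, fun t => ?_⟩).symm⟩
  · have h1 := congrArg Subtype.val h
    change C * _ * C' = C * _ * C' at h1
    have h2 := congrArg (fun w => C' * w * C) h1
    simp only [mul_assoc, hC'C, mul_one] at h2
    simp only [← mul_assoc, hC'C, one_mul] at h2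
    funext i
    exact Subtype.ext (congrFun (D.glue_injective h2) i)
  · obtain ⟨w, ⟨p, hp, rfl⟩, h⟩ := hsurj t t.2
    exact ⟨fun i => ⟨p i, hp i⟩, Subtype.ext h⟩

end IsRCrossSection

/-! ### Duality -/

/-- An inverse semigroup has an involutive antiautomorphism. -/
theorem IsInverseSemigroup.exists_involution {H : Type u} [Semigroup H]
    (hH : IsInverseSemigroup H) :
    ∃ σ : H → H, (∀ a b, σ (a * b) = σ b * σ a) ∧ ∀ a, σ (σ a) = a := by
  choose σ hσ using fun a => (hH a).exists
  have huniq : ∀ a b, a * b * a = a → b * a * b = b → b = σ a := fun a b h h' =>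
    (hH a).unique ⟨h, h'⟩ (hσ a)
  have hprod : ∀ e f : H, e * e = e → f * f = f → e * f * (e * f) = e * f := by
    intro e f he hf
    obtain ⟨h1, h2⟩ := hσ (e * f)
    -- Uniqueness of inverses makes the inverse of ef equal to f · (ef)⁻¹ · e, which is idempotent.
    -- Idempotents are their own inverses, so ef is idempotent too.
    have hx : f * σ (e * f) * e = σ (e * f) := by
      apply huniq
      · calc e * f * (f * σ (e * f) * e) * (e * f)
            = e * (f * f) * σ (e * f) * (e * e) * f := by simp only [mul_assoc]
          _ = e * f * σ (e * f) * (e * f) := by rw [he, hf]; simp only [mul_assoc]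
          _ = e * f := h1
      · calc f * σ (e * f) * e * (e * f) * (f * σ (e * f) * e)
            = f * (σ (e * f) * ((e * e) * (f * f)) * σ (e * f)) * e := by simp only [mul_assoc]
          _ = f * σ (e * f) * e := by rw [he, hf, h2]
    have hid : σ (e * f) * σ (e * f) = σ (e * f) := by
      calc σ (e * f) * σ (e * f) = f * σ (e * f) * e * (f * σ (e * f) * e) := by rw [hx]
        _ = f * (σ (e * f) * (e * f) * σ (e * f)) * e := by simp only [mul_assoc]
        _ = σ (e * f) := by rw [h2, hx]
    have h3 : e * f = σ (σ (e * f)) := huniq _ _ h2 h1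
    have h4 : σ (e * f) = σ (σ (e * f)) := huniq _ _ (by rw [hid, hid]) (by rw [hid, hid])
    rw [h3, ← h4, hid]
  have hcomm : ∀ e f : H, e * e = e → f * f = f → e * f = f * e := by
    intro e f he hf
    have h1 := hprod e f he hf
    have h2 := hprod f e hf he
    have h3 : e * f = σ (e * f) := huniq _ _ (by rw [h1, h1]) (by rw [h1, h1])
    have h4 : f * e = σ (e * f) := by
      apply huniq
      · calc e * f * (f * e) * (e * f) = e * (f * f) * (e * e) * f := by simp only [mul_assoc]
          _ = e * f * (e * f) := by rw [he, hf]; simp only [mul_assoc]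
          _ = e * f := h1
      · calc f * e * (e * f) * (f * e) = f * (e * e) * (f * f) * e := by simp only [mul_assoc]
          _ = f * e * (f * e) := by rw [he, hf]; simp only [mul_assoc]
          _ = f * e := h2
    rw [h3, ← h4]
  have hr : ∀ a, a * σ a * (a * σ a) = a * σ a := fun a => by rw [← mul_assoc, (hσ a).1]
  have hl : ∀ a, σ a * a * (σ a * a) = σ a * a := fun a => by rw [← mul_assoc, (hσ a).2]
  refine ⟨σ, fun a b => (huniq _ _ ?_ ?_).symm, fun a => (huniq _ _ (hσ a).2 (hσ a).1).symm⟩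
  · calc a * b * (σ b * σ a) * (a * b)
        = a * ((b * σ b) * (σ a * a)) * b := by simp only [mul_assoc]
      _ = a * ((σ a * a) * (b * σ b)) * b := by rw [hcomm _ _ (hr b) (hl a)]
      _ = (a * σ a * a) * (b * σ b * b) := by simp only [mul_assoc]
      _ = a * b := by rw [(hσ a).1, (hσ b).1]
  · calc σ b * σ a * (a * b) * (σ b * σ a)
        = σ b * ((σ a * a) * (b * σ b)) * σ a := by simp only [mul_assoc]
      _ = σ b * ((b * σ b) * (σ a * a)) * σ a := by rw [hcomm _ _ (hl a) (hr b)]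
      _ = (σ b * b * σ b) * (σ a * a * σ a) := by simp only [mul_assoc]
      _ = σ b * σ a := by rw [(hσ a).2, (hσ b).2]

/-- The preimage of a subsemigroup under an antihomomorphism. -/
def Subsemigroup.revComap {H : Type u} [Semigroup H] (τ : H → H)
    (hτ : ∀ a b, τ (a * b) = τ b * τ a) (T : Subsemigroup H) : Subsemigroup H where
  carrier := {a | τ a ∈ T}
  mul_mem' {a b} ha hb := by
    rw [Set.mem_ofPred_eq, hτ]
    exact mul_mem hb ha

theorem Subsemigroup.map_mem_revComap {H : Type u} [Semigroup H] {τ : H → H}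
    (hτ : ∀ a b, τ (a * b) = τ b * τ a) (hinv : ∀ a, τ (τ a) = a) {T : Subsemigroup H} {a : H}
    (ha : a ∈ T) : τ a ∈ T.revComap τ hτ := by
  change τ (τ a) ∈ T
  rwa [hinv]

theorem greenL_iff_greenR {H : Type u} [Semigroup H] {τ : H → H}
    (hτ : ∀ a b, τ (a * b) = τ b * τ a) (hinv : ∀ a, τ (τ a) = a) {a b : H} :
    GreenL a b ↔ GreenR (τ a) (τ b) := by
  have hinj : Function.Injective τ := Function.LeftInverse.injective hinv
  have key : ∀ c, τ '' insert c (Set.range fun h : H => h * c) =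
      insert (τ c) (Set.range fun h : H => τ c * h) := by
    intro c
    rw [Set.image_insert_eq, ← Set.range_comp]
    congr 1
    ext d
    constructor
    · rintro ⟨h, rfl⟩
      exact ⟨τ h, (hτ h c).symm⟩
    · rintro ⟨h, rfl⟩
      exact ⟨τ h, by rw [Function.comp_apply, hτ, hinv]⟩
  unfold GreenL GreenR
  rw [← key, ← key, hinj.image_injective.eq_iff]

theorem isLCrossSection_iff_revComap {H : Type u} [Semigroup H] {τ : H → H}
    (hτ : ∀ a b, τ (a * b) = τ b * τ a) (hinv : ∀ a, τ (τ a) = a) {T : Subsemigroup H} :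
    IsLCrossSection T ↔ IsRCrossSection (T.revComap τ hτ) := by
  have key : ∀ a, (∃! t, t ∈ T ∧ GreenL a t) ↔
      ∃! t, t ∈ T.revComap τ hτ ∧ GreenR (τ a) t := by
    intro a
    constructor
    · rintro ⟨t, ⟨ht, h⟩, hu⟩
      refine ⟨τ t, ⟨T.map_mem_revComap hτ hinv ht, (greenL_iff_greenR hτ hinv).mp h⟩, fun s hs => ?_⟩
      rw [← hu (τ s) ⟨hs.1, (greenL_iff_greenR hτ hinv).mpr ((hinv s).symm ▸ hs.2)⟩, hinv]
    · rintro ⟨t, ⟨ht, h⟩, hu⟩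
      refine ⟨τ t, ⟨ht, (greenL_iff_greenR hτ hinv).mpr ((hinv t).symm ▸ h)⟩, fun s hs => ?_⟩
      rw [← hu (τ s) ⟨T.map_mem_revComap hτ hinv hs.1, (greenL_iff_greenR hτ hinv).mp hs.2⟩, hinv]
  constructor
  · intro h a
    rw [← hinv a]
    exact (key _).mp (h _)
  · exact fun h a => (key a).mpr (h _)

/-! ### The induced antiautomorphism of the partial wreath product -/

namespace PWreath

variable {S : Type v} {X : Type u}

/-- The image of `(f, a)` under the antiautomorphism induced by an antiautomorphism of `S`. -/
def rev (σ : S → S) (w : PWreath S X) : PWreath S X where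
  fn y := (w.act.inv.app y).bind fun x => (w.fn x).map σ
  act := w.act.inv
  dom_eq y := by
    cases h : w.act.inv.app y with
    | none => simp
    | some x =>
      rw [Option.bind_some, Option.isSome_map, w.dom_eq, ISym.inv_app.mp h, Option.isSome_some,
        Option.isSome_some]

theorem rev_act (σ : S → S) (w : PWreath S X) : (w.rev σ).act = w.act.inv := rfl

theorem rev_fn_some {σ : S → S} {w : PWreath S X} {y : X} {t : S} :
    (w.rev σ).fn y = some t ↔ ∃ x s, w.act.app x = some y ∧ w.fn x = some s ∧ σ s = t := by
  change (w.act.inv.app y).bind (fun x => (w.fn x).map σ) = some t ↔ _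
  simp only [Option.bind_eq_some_iff, Option.map_eq_some_iff, ISym.inv_app, exists_and_left]

theorem rev_rev {σ : S → S} (hinv : ∀ a, σ (σ a) = a) (w : PWreath S X) :
    (w.rev σ).rev σ = w := by
  refine PWreath.ext ?_ (ISym.inv_inv _)
  funext x
  apply Option.ext
  intro r
  rw [rev_fn_some]
  constructor
  · rintro ⟨y, s, hy, hs, rfl⟩
    obtain ⟨x', s, hx', hs', rfl⟩ := rev_fn_some.mp hs
    rw [rev_act, ISym.inv_app] at hy
    rw [hinv, ← hs', ISym.app_inj hy hx']
  · intro hr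
    obtain ⟨y, hy⟩ : x ∈ w.act.dom := mem_dom_act.mpr ⟨r, hr⟩
    exact ⟨y, σ r, ISym.inv_app.mpr hy, rev_fn_some.mpr ⟨x, r, hy, hr, rfl⟩, hinv r⟩

theorem rev_mul [Semigroup S] {σ : S → S} (hσ : ∀ a b, σ (a * b) = σ b * σ a)
    (w z : PWreath S X) : (w * z).rev σ = z.rev σ * w.rev σ := by
  refine PWreath.ext ?_ (ISym.inv_mul _ _)
  funext y
  apply Option.ext
  intro r
  rw [rev_fn_some, mul_fn_some]
  constructor
  · rintro ⟨x, q, hx, hq, rfl⟩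
    obtain ⟨s, t, u, hs, hu, ht, rfl⟩ := mul_fn_some.mp hq
    rw [mul_act, ISym.mul_app_of _ hu] at hx
    exact ⟨σ t, σ s, u, rev_fn_some.mpr ⟨u, t, hx, ht, rfl⟩, ISym.inv_app.mpr hx,
      rev_fn_some.mpr ⟨x, s, hu, hs, rfl⟩, (hσ s t).symm⟩
  · rintro ⟨t', s', u, ht, hu, hs, rfl⟩
    rw [rev_act, ISym.inv_app] at hu
    obtain ⟨u', t, hu', ht, rfl⟩ := rev_fn_some.mp ht
    obtain rfl := ISym.app_inj hu hu'
    obtain ⟨x, s, hx, hsx, rfl⟩ := rev_fn_some.mp hs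
    exact ⟨x, s * t, ISym.mul_app_some.mpr ⟨u, hx, hu⟩,
      mul_fn_some.mpr ⟨s, t, u, hsx, hx, ht, rfl⟩, hσ s t⟩

end PWreath

namespace OrderedDecomposition

open PWreath

variable {S : Type v} {X : Type u} [Semigroup S] (D : OrderedDecomposition X) {σ : S → S}

theorem glue_rev (p : ∀ i, PWreath S (D.block i)) :
    D.glue (fun i => (p i).rev σ) = (D.glue p).rev σ := by
  have hact : ∀ a : ∀ i, ISym (D.block i), D.glueAct (fun i => (a i).inv) = (D.glueAct a).inv := by
    intro a
    apply ISym.ext_some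
    intro y x
    rw [ISym.inv_app]
    obtain ⟨i, y, rfl⟩ := D.exists_block y
    obtain ⟨j, x, rfl⟩ := D.exists_block x
    simp only [glueAct_app, Option.map_eq_some_iff]
    constructor
    · rintro ⟨x', h, e⟩
      obtain rfl : i = j := (D.idx_eq x'.2).symm.trans (D.idx_eq (e ▸ x.2))
      obtain rfl := Subtype.ext e
      exact ⟨y, ISym.inv_app.mp h, rfl⟩
    · rintro ⟨y', h, e⟩
      obtain rfl : j = i := (D.idx_eq y'.2).symm.trans (D.idx_eq (e ▸ y.2))
      obtain rfl := Subtype.ext e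
      exact ⟨x, ISym.inv_app.mpr h, rfl⟩
  refine PWreath.ext ?_ (hact _)
  funext y
  obtain ⟨i, y, rfl⟩ := D.exists_block y
  rw [glue_fn]
  change ((p i).act.inv.app y).bind _ = ((D.glue p).act.inv.app y).bind _
  rw [glue_act, ← hact, glueAct_app]
  cases (p i).act.inv.app y with
  | none => rfl
  | some x => simp only [Option.map_some, Option.bind_some, glue_fn]

theorem mem_factorL_iff (hσ : ∀ a b, σ (a * b) = σ b * σ a) (hinv : ∀ a, σ (σ a) = a)
    (L : Fin D.k → Subsemigroup S) {i : Fin D.k} (w : PWreath S (D.block i)) :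
    w ∈ D.factorL L i ↔ w.rev σ ∈ D.factorR (fun i => (L i).revComap σ hσ) i := by
  refine and_congr Iff.rfl ⟨fun h y t ht => ?_, fun h x s hs => ?_⟩
  · obtain ⟨x, s, -, hs, rfl⟩ := rev_fn_some.mp ht
    exact (L i).map_mem_revComap hσ hinv (h x s hs)
  · obtain ⟨y, hy⟩ : x ∈ w.act.dom := mem_dom_act.mpr ⟨s, hs⟩
    exact hinv s ▸ h y (σ s) (rev_fn_some.mpr ⟨x, s, hy, hs, rfl⟩)

theorem revComap_prodIn_factorL (hσ : ∀ a b, σ (a * b) = σ b * σ a) (hinv : ∀ a, σ (σ a) = a)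
    (L : Fin D.k → Subsemigroup S) :
    (D.prodIn (D.factorL L)).revComap (rev σ) (rev_mul hσ) =
      D.prodIn (D.factorR fun i => (L i).revComap σ hσ) := by
  ext w
  constructor
  · rintro ⟨p, hp, h⟩
    refine ⟨fun i => (p i).rev σ, fun i => (D.mem_factorL_iff hσ hinv L _).mp (hp i), ?_⟩
    rw [glue_rev, h, rev_rev hinv]
  · rintro ⟨p, hp, rfl⟩
    refine ⟨fun i => (p i).rev σ, fun i => (D.mem_factorL_iff hσ hinv L _).mpr ?_, D.glue_rev p⟩
    rw [rev_rev hinv]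
    exact hp i

end OrderedDecomposition

theorem isLCrossSection_prodIn {S : Type v} {X : Type u} [Monoid S] [Finite X]
    (hS : IsInverseSemigroup S) (D : OrderedDecomposition X) {L : Fin D.k → Subsemigroup S}
    (hL : ∀ i, IsLCrossSection (L i)) : IsLCrossSection (D.prodIn (D.factorL L)) := by
  obtain ⟨σ, hσ, hinv⟩ := hS.exists_involution
  rw [isLCrossSection_iff_revComap (PWreath.rev_mul hσ) (PWreath.rev_rev hinv),
    D.revComap_prodIn_factorL hσ hinv]
  exact isRCrossSection_prodIn D fun i => (isLCrossSection_iff_revComap hσ hinv).mp (hL i)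

theorem IsLCrossSection.exists_mulEquiv {S : Type v} {X : Type u} [MonoidWithZero S] [Finite S]
    [Finite X] (hS : IsInverseSemigroup S) {T : Subsemigroup (PWreath S X)}
    (hT : IsLCrossSection T) :
    ∃ (D : OrderedDecomposition X) (L : Fin D.k → Subsemigroup S),
      (∀ i, IsLCrossSection (L i)) ∧ Nonempty (T ≃* (∀ i, D.factorL L i)) := by
  classical
  obtain ⟨σ, hσ, hinv⟩ := hS.exists_involution
  have hrev := PWreath.rev_rev (X := X) hinv
  rw [isLCrossSection_iff_revComap (PWreath.rev_mul hσ) hrev] at hT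
  obtain ⟨D, R, hR, ⟨φ⟩⟩ := hT.exists_mulEquiv
  have hRR : ∀ i, ((R i).revComap σ hσ).revComap σ hσ = R i := fun i =>
    Subsemigroup.ext fun s => (iff_of_eq (congrArg (· ∈ R i) (hinv s)) :)
  have hmem : ∀ i (w : PWreath S (D.block i)),
      w ∈ D.factorL (fun i => (R i).revComap σ hσ) i ↔ w.rev σ ∈ D.factorR R i := by
    intro i w
    rw [D.mem_factorL_iff hσ hinv]
    simp only [hRR]
  refine ⟨D, fun i => (R i).revComap σ hσ, fun i =>
    (isLCrossSection_iff_revComap hσ hinv).mpr ((hRR i).symm ▸ hR i), ⟨?_⟩⟩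
  -- The isomorphism for the reversed semigroup is composed with `rev` on both sides; the two
  -- reversals of order cancel.
  exact
    { toFun := fun t i => ⟨(φ ⟨t.1.rev σ, T.map_mem_revComap _ hrev t.2⟩ i).1.rev σ,
        (hmem i _).mpr ((PWreath.rev_rev hinv _).symm ▸ (φ _ i).2)⟩
      invFun := fun p => ⟨(φ.symm fun i => ⟨(p i).1.rev σ, (hmem i _).mp (p i).2⟩).1.rev σ,
        (φ.symm _).2⟩
      left_inv := fun t => by simp [PWreath.rev_rev hinv]
      right_inv := fun p => by simp [PWreath.rev_rev hinv]
      map_mul' := fun s t => by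
        funext i
        apply Subtype.ext
        have e : (⟨(s * t).1.rev σ, T.map_mem_revComap _ hrev (s * t).2⟩ : T.revComap _ (PWreath.rev_mul hσ))
            = ⟨t.1.rev σ, T.map_mem_revComap _ hrev t.2⟩ * ⟨s.1.rev σ, T.map_mem_revComap _ hrev s.2⟩ :=
          Subtype.ext (PWreath.rev_mul hσ s.1 t.1)
        simp only [e, map_mul]
        exact PWreath.rev_mul hσ _ _ }

theorem mainTheorem1 {S : Type*} [MonoidWithZero S] [Finite S] (hS : IsInverseSemigroup S)
    (n : ℕ) :
    ((∀ (D : OrderedDecomposition (Fin n)) (R : Fin D.k → Subsemigroup S),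
        (∀ i, IsRCrossSection (R i)) → IsRCrossSection (D.prodIn (D.factorR R))) ∧
      (∀ T : Subsemigroup (PWreath S (Fin n)), IsRCrossSection T →
        ∃ (D : OrderedDecomposition (Fin n)) (R : Fin D.k → Subsemigroup S),
          (∀ i, IsRCrossSection (R i)) ∧ Nonempty (T ≃* (∀ i, D.factorR R i)))) ∧
    ((∀ (D : OrderedDecomposition (Fin n)) (L : Fin D.k → Subsemigroup S),
        (∀ i, IsLCrossSection (L i)) → IsLCrossSection (D.prodIn (D.factorL L))) ∧
      (∀ T : Subsemigroup (PWreath S (Fin n)), IsLCrossSection T →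
        ∃ (D : OrderedDecomposition (Fin n)) (L : Fin D.k → Subsemigroup S),
          (∀ i, IsLCrossSection (L i)) ∧ Nonempty (T ≃* (∀ i, D.factorL L i)))) :=
  ⟨⟨fun D _ hR => isRCrossSection_prodIn D hR, fun _ hT => hT.exists_mulEquiv⟩,
    ⟨fun D _ hL => isLCrossSection_prodIn hS D hL, fun _ hT => hT.exists_mulEquiv hS⟩⟩
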